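/- All manifolds are smooth, finite dimensional, Hausdorff and second countable. Let $\mathcal G$ and $\mathcal H$ be Lie groupoids, with manifold of objects $X_{\mathcal G}$, source $s_{\mathcal G}$, target $t_{\mathcal G}$ (surjective submersions), and product $g_1g_2$ defined when $s_{\mathcal G}(g_1)=t_{\mathcal G}(g_2)$. **Definitions.** A *principal $\mathcal H$-bundle* over a manifold $M$ is a manifold $P$ with a surjective submersion $\pi:P\to M$, a smooth momentum $\varepsilon:P\to X_{\mathcal H}$ and a smooth right action $(p,h)\mapsto ph$ of $\mathcal H$, defined when $\varepsilon(p)=t_{\mathcal H}(h)$, with $\varepsilon(ph)=s_{\mathcal H}(h)$ and $\pi(ph)=\pi(p)$, such that $(p,h)\mapsto(p,ph)$ is a diffeomorphism $P\times_{X_{\mathcal H}}\mathcal H\to P\times_MP$. A *morphism* of principal $\mathcal H$-bundles over $M$ is a smooth equivariant map over $M$ that preserves the momenta (every morphism is invertible). The pull-back of $P$ along $f:N\to M$ is $f^*P=\{(n,p): f(n)=\pi(p)\}$. A *generalized morphism* $\mathcal G\to\mathcal H$ is a principal $\mathcal H$-bundle $P$ over $X_{\mathcal G}$ with a smooth left $\mathcal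 G$-action $(g,p)\mapsto gp$, defined when $s_{\mathcal G}(g)=\pi(p)$, with $\pi(gp)=t_{\mathcal G}(g)$, $\varepsilon(gp)=\varepsilon(p)$ and $(gp)h=g(ph)$. Two of them are *equivalent* if there is a $\mathcal G$-equivariant morphism of principal $\mathcal H$-bundles over $X_{\mathcal G}$ between them. Consider pairs $(P,\Theta)$ of a principal $\mathcal H$-bundle $P$ over $X_{\mathcal G}$ and a morphism $\Theta:s_{\mathcal G}^*P\to t_{\mathcal G}^*P$ such that $\mu^*\Theta=\mathrm{pr}_1^*\Theta\circ\mathrm{pr}_2^*\Theta$ over $\mathcal G_2=\{(g_1,g_2): s_{\mathcal G}(g_1)=t_{\mathcal G}(g_2)\}$, where $\mu,\mathrm{pr}_1,\mathrm{pr}_2:\mathcal G_2\to\mathcal G$ are the product and the projections, and $\mu^*s_{\mathcal G}^*P=\mathrm{pr}_2^*s_{\mathcal G}^*P$, $\mathrm{pr}_2^*t_{\mathcal G}^*P=\mathrm{pr}_1^*s_{\mathcal G}^*P$, $\mathrm{pr}_1^*t_{\mathcal G}^*P=\mu^*t_{\mathcal G}^*P$ are identified. Two pairs $(P,\Theta)$,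 $(Q,H)$ are *equivalent* if there is a morphism $\Sigma:P\to Q$ with $t_{\mathcal G}^*\Sigma\circ\Theta=H\circ s_{\mathcal G}^*\Sigma$. A *1-cocycle* on an open covering $(U_\alpha)$ of a manifold, with values in $\mathcal H$, consists of smooth maps $\varepsilon_\alpha:U_\alpha\to X_{\mathcal H}$ and $\Phi_{\alpha\beta}:U_\alpha\cap U_\beta\to\mathcal H$ with $t_{\mathcal H}\Phi_{\alpha\beta}=\varepsilon_\alpha$, $s_{\mathcal H}\Phi_{\alpha\beta}=\varepsilon_\beta$, $\Phi_{\alpha\alpha}=1_{\varepsilon_\alpha}$ and $\Phi_{\alpha\beta}\Phi_{\beta\gamma}=\Phi_{\alpha\gamma}$. Two 1-cocycles $(\varepsilon,\Phi)$, $(\varepsilon',\Phi')$ are *cohomologous* if there are smooth $\Sigma_\alpha:U_\alpha\to\mathcal H$ with $s_{\mathcal H}\Sigma_\alpha=\varepsilon_\alpha$, $t_{\mathcal H}\Sigma_\alpha=\varepsilon'_\alpha$ and $\Phi'_{\alpha\beta}=\Sigma_\alpha\Phi_{\alpha\beta}\Sigma_\beta^{-1}$. Smooth local sections $\sigma_\alpha$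 of a principal bundle $P$ over $U_\alpha$ define the *cocycle of $P$* given by $\varepsilon_\alpha=\varepsilon\circ\sigma_\alpha$ and $\sigma_\beta=\sigma_\alpha\Phi_{\alpha\beta}$. Let $\mathcal G_n$ be the manifold of $n$-tuples $(g_1,\dots,g_n)$ of arrows with $s_{\mathcal G}(g_i)=t_{\mathcal G}(g_{i+1})$ (and $\mathcal G_0=X_{\mathcal G}$). Its vertices are $t_{\mathcal G}(g_1),\ s_{\mathcal G}(g_1)=t_{\mathcal G}(g_2),\ \dots,\ s_{\mathcal G}(g_n)$, numbered $0,\dots,n$. An open covering $\mathfrak U=(U_\alpha)$ of $X_{\mathcal G}$ induces the open covering $\mathfrak U^n$ of $\mathcal G_n$ by the sets $U_{\alpha_0,\dots,\alpha_n}$ of all tuples whose $i$-th vertex lies in $U_{\alpha_i}$ for all $i$. Let $H^1(\mathcal G_n,\mathcal S_{\mathcal G_n,\mathcal H})$ be the direct limit, over the open coverings $\mathfrak U$ of $X_{\mathcal G}$ and their refinements, of the sets of cohomology classes of 1-cocycles on $\mathfrak U^n$ with values in $\mathcal H$. The face map $\iota_{k,n}:\mathcal G_n\to\mathcal G_{n-1}$,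 $0\le k\le n$, drops the $k$-th vertex. Pull-back along $\iota_{k,n}$, followed by restriction to $\mathfrak U^n$ by forgetting the $k$-th index, induces $\rho_{k,n}:H^1(\mathcal G_{n-1},\mathcal S_{\mathcal G_{n-1},\mathcal H})\to H^1(\mathcal G_n,\mathcal S_{\mathcal G_n,\mathcal H})$. **Theorem.** 1. There is a bijection between the equivalence classes of generalized morphisms $\mathcal G\to\mathcal H$ and the equivalence classes of pairs $(P,\Theta)$ as above. It sends the class of a generalized morphism with underlying bundle $P$ to the class of $(P,\Theta)$, where $\Theta(g,p)=(g,gp)$ is a morphism that satisfies the compatibility condition. 2. There is a unique way to assign to every equivalence class $x$ of generalized morphisms $\mathcal G\to\mathcal H$ a sequence of classes $c_n(x)\in H^1(\mathcal G_n,\mathcal S_{\mathcal G_n,\mathcal H})$, $n\ge0$, such that $\rho_{k,n}(c_{n-1}(x))=c_n(x)$ for all $n\ge1$ and all $0\le k\le n$, and such that $c_0(x)$ is the class of every cocycle of the principal $\mathcal H$-bundle underlying any generalized morphism that represents $x$. -/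

import Mathlib

open scoped Manifold ContDiff
open TopologicalSpace

universe u

/-- A smooth manifold: Hausdorff, second countable, finite dimensional, without boundary. -/
structure Mfd : Type (u + 1) where
  carrier : Type u
  model : Type
  [normedGroup : NormedAddCommGroup model]
  [normedSpace : NormedSpace ℝ model]
  [finiteDimensional : FiniteDimensional ℝ model]
  [topology : TopologicalSpace carrier]
  [t2 : T2Space carrier]
  [secondCountable : SecondCountableTopology carrier]
  [charted : ChartedSpace model carrier]
  [isManifold : IsManifold 𝓘(ℝ, model) ∞ carrier]

namespace Mfd

instance : CoeSort Mfd.{u} (Type u) := ⟨Mfd.carrier⟩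

attribute [instance] normedGroup normedSpace finiteDimensional topology t2 secondCountable
  charted isManifold

/-- Smooth maps. -/
def Smooth {M N : Mfd.{u}} (f : M → N) : Prop :=
  ContMDiff 𝓘(ℝ, M.model) 𝓘(ℝ, N.model) ∞ f

/-- Submersions: smooth maps which are linear projections in suitable charts. -/
def Submersion {M N : Mfd.{u}} (f : M → N) : Prop :=
  Manifold.IsSubmersion 𝓘(ℝ, M.model) 𝓘(ℝ, N.model) ∞ f

theorem Submersion.smooth {M N : Mfd.{u}} {f : M → N} (hf : Submersion f) : Smooth f :=
  Manifold.IsSubmersion.contMDiff hf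

theorem Submersion.exists_complement {M N : Mfd.{u}} {f : M → N} (hf : Submersion f) :
    ∃ (F : Type) (_ : NormedAddCommGroup F) (_ : NormedSpace ℝ F) (_ : FiniteDimensional ℝ F),
      Manifold.IsSubmersionOfComplement F 𝓘(ℝ, M.model) 𝓘(ℝ, N.model) ∞ f := by
  obtain ⟨F, i1, i2, h⟩ := hf
  by_cases hM : Nonempty M
  · obtain ⟨x⟩ := hM
    have e := (h x).equiv
    have : FiniteDimensional ℝ (N.model × F) := LinearEquiv.finiteDimensional e.toLinearEquiv
    have : FiniteDimensional ℝ F :=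
      FiniteDimensional.of_surjective (LinearMap.snd ℝ N.model F) LinearMap.snd_surjective
    exact ⟨F, i1, i2, this, h⟩
  · exact ⟨PUnit, inferInstance, inferInstance, inferInstance, fun x => (hM ⟨x⟩).elim⟩

/-- Points of the fibre product of `f : M → N` and `π : P → N`. -/
@[ext]
structure Fib {M N P : Mfd.{u}} (f : M → N) (π : P → N) : Type u where
  fst : M
  snd : P
  w : f fst = π snd

namespace Fib

variable {M N P : Mfd.{u}} {f : M → N} {π : P → N}

/-- The inclusion of the fibre product into the product. -/
def toProd (z : Fib f π) : M × P := (z.fst, z.snd)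

instance : TopologicalSpace (Fib f π) := TopologicalSpace.induced toProd inferInstance

theorem isInducing_toProd : Topology.IsInducing (toProd (f := f) (π := π)) := ⟨rfl⟩

theorem toProd_injective : Function.Injective (toProd (f := f) (π := π)) := fun a b h => by
  simp only [toProd, Prod.mk.injEq] at h
  exact Fib.ext h.1 h.2

instance : T2Space (Fib f π) :=
  T2Space.of_injective_continuous toProd_injective isInducing_toProd.continuous

instance : SecondCountableTopology (Fib f π) := isInducing_toProd.secondCountableTopology

theorem continuous_fst : Continuous (fst (f := f) (π := π)) :=
  _root_.continuous_fst.comp isInducing_toProd.continuous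

theorem continuous_snd : Continuous (snd (f := f) (π := π)) :=
  _root_.continuous_snd.comp isInducing_toProd.continuous

open Manifold

variable {F : Type} [NormedAddCommGroup F] [NormedSpace ℝ F] (x : M) {p : P}
  (h : IsSubmersionAtOfComplement F 𝓘(ℝ, P.model) 𝓘(ℝ, N.model) ∞ π p)

theorem normalForm {w : P.model} (hw : w ∈ h.domChart.target) :
    h.codChart (π (h.domChart.symm w)) = (h.equiv w).1 := by
  have := @IsSubmersionAtOfComplement.writtenInCharts _ _ _ _ _ _ _ _ _ _ _ _ _ _ _ _ _ _ _ _ _ _ _ _ _ _ h w (by simpa using hw)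
  simpa using this

variable (f) in
/-- The second component of the inverse of a chart of the fibre product. -/
noncomputable def invSnd (w : M.model × F) : P :=
  h.domChart.symm (h.equiv.symm (h.codChart (f ((chartAt M.model x).symm w.1)), w.2))

variable (f) in
/-- The image of a chart of the fibre product. -/
def chartTarget : Set (M.model × F) :=
  {w | w.1 ∈ (chartAt M.model x).target ∧
    f ((chartAt M.model x).symm w.1) ∈ h.codChart.source ∧
    h.equiv.symm (h.codChart (f ((chartAt M.model x).symm w.1)), w.2) ∈ h.domChart.target}

theorem invSnd_eq {w : M.model × F} (hw : w ∈ chartTarget f x h) :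
    f ((chartAt M.model x).symm w.1) = π (invSnd f x h w) := by
  obtain ⟨-, h2, h3⟩ := hw
  refine h.codChart.injOn h2 (h.source_subset_preimage_source (h.domChart.map_target h3)) ?_
  rw [invSnd, normalForm h h3]
  simp

theorem equiv_symm_eq (z : Fib f π) (hz : z.snd ∈ h.domChart.source) :
    h.equiv.symm (h.codChart (f z.fst), (h.equiv (h.domChart z.snd)).2) = h.domChart z.snd := by
  have h4 := normalForm h (h.domChart.map_source hz)
  rw [h.domChart.left_inv hz] at h4
  rw [z.w, h4]
  simp

theorem continuousOn_aux (hf : Continuous f) :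
    ContinuousOn (fun w : M.model × F =>
      h.equiv.symm (h.codChart (f ((chartAt M.model x).symm w.1)), w.2))
      {w | w.1 ∈ (chartAt M.model x).target ∧
        f ((chartAt M.model x).symm w.1) ∈ h.codChart.source} := by
  refine h.equiv.symm.continuous.comp_continuousOn (ContinuousOn.prodMk ?_ continuousOn_snd)
  refine h.codChart.continuousOn.comp (hf.comp_continuousOn ?_) fun w hw => hw.2
  exact (chartAt M.model x).continuousOn_symm.comp continuousOn_fst fun w hw => hw.1

open Classical in
/-- The chart of the fibre product around `(x, p)`: near `p`, the submersion `π` is the linear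
projection `N.model × F → N.model`; the coordinates of `(m, q)` are those of `m` in `M` and the
`F`-coordinate of `q`. -/
noncomputable def chart (hf : Continuous f) (z₀ : Fib f π) :
    OpenPartialHomeomorph (Fib f π) (M.model × F) where
  toFun z := (chartAt M.model x z.fst, (h.equiv (h.domChart z.snd)).2)
  invFun w := if hw : w ∈ chartTarget f x h then
    ⟨(chartAt M.model x).symm w.1, invSnd f x h w, invSnd_eq x h hw⟩ else z₀
  source := {z | z.fst ∈ (chartAt M.model x).source ∧ z.snd ∈ h.domChart.source}
  target := chartTarget f x h
  map_source' := by
    intro z ⟨h1, h2⟩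
    refine ⟨(chartAt M.model x).map_source h1, ?_, ?_⟩
    · simp only [(chartAt M.model x).left_inv h1, z.w]
      exact h.source_subset_preimage_source h2
    · simp only [(chartAt M.model x).left_inv h1, equiv_symm_eq h z h2]
      exact h.domChart.map_source h2
  map_target' := by
    intro w hw
    rw [dif_pos hw]
    exact ⟨(chartAt M.model x).map_target hw.1, h.domChart.map_target hw.2.2⟩
  left_inv' := by
    intro z ⟨h1, h2⟩
    have hw : (chartAt M.model x z.fst, (h.equiv (h.domChart z.snd)).2) ∈ chartTarget f x h := by
      refine ⟨(chartAt M.model x).map_source h1, ?_, ?_⟩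
      · simp only [(chartAt M.model x).left_inv h1, z.w]
        exact h.source_subset_preimage_source h2
      · simp only [(chartAt M.model x).left_inv h1, equiv_symm_eq h z h2]
        exact h.domChart.map_source h2
    rw [dif_pos hw]
    refine Fib.ext ((chartAt M.model x).left_inv h1) ?_
    simp only [invSnd, (chartAt M.model x).left_inv h1, equiv_symm_eq h z h2,
      h.domChart.left_inv h2]
  right_inv' := by
    intro w hw
    rw [dif_pos hw]
    refine Prod.ext ((chartAt M.model x).right_inv hw.1) ?_
    simp [invSnd, h.domChart.right_inv hw.2.2]
  open_source := ((chartAt M.model x).open_source.preimage continuous_fst).inter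
    (h.domChart.open_source.preimage continuous_snd)
  open_target := by
    have h1 : IsOpen {w : M.model × F | w.1 ∈ (chartAt M.model x).target ∧
        f ((chartAt M.model x).symm w.1) ∈ h.codChart.source} := by
      have := (((chartAt M.model x).continuousOn_symm.comp
        (continuousOn_fst (s := Prod.fst ⁻¹' (chartAt M.model x).target) (β := F))
        fun w hw => hw))
      exact (hf.comp_continuousOn this).isOpen_inter_preimage
        ((chartAt M.model x).open_target.preimage _root_.continuous_fst) h.codChart.open_source
    have := (continuousOn_aux x h hf).isOpen_inter_preimage h1 h.domChart.open_target
    convert this using 1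
    ext w
    simp [chartTarget, and_assoc]
  continuousOn_toFun := by
    refine ContinuousOn.prodMk ?_ ?_
    · exact (chartAt M.model x).continuousOn.comp continuous_fst.continuousOn fun z hz => hz.1
    · refine _root_.continuous_snd.comp_continuousOn (h.equiv.continuous.comp_continuousOn ?_)
      exact h.domChart.continuousOn.comp continuous_snd.continuousOn fun z hz => hz.2
  continuousOn_invFun := by
    rw [isInducing_toProd.continuousOn_iff]
    have : ContinuousOn (fun w : M.model × F => ((chartAt M.model x).symm w.1, invSnd f x h w))
        (chartTarget f x h) := by
      refine ContinuousOn.prodMk ?_ ?_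
      · exact (chartAt M.model x).continuousOn_symm.comp continuousOn_fst fun w hw => hw.1
      · exact h.domChart.continuousOn_symm.comp
          ((continuousOn_aux x h hf).mono fun w hw => ⟨hw.1, hw.2.1⟩) fun w hw => hw.2.2
    refine this.congr fun w hw => ?_
    simp only [Function.comp, dif_pos hw, toProd]

end Fib

/-- A complement of the model space of `N` in that of `P`, for a submersion `π : P → N`. -/
def Submersion.Compl {P N : Mfd.{u}} {π : P → N} (hπ : Submersion π) : Type :=
  hπ.exists_complement.choose

noncomputable instance {P N : Mfd.{u}} {π : P → N} (hπ : Submersion π) :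
    NormedAddCommGroup hπ.Compl := hπ.exists_complement.choose_spec.choose

noncomputable instance {P N : Mfd.{u}} {π : P → N} (hπ : Submersion π) :
    NormedSpace ℝ hπ.Compl := hπ.exists_complement.choose_spec.choose_spec.choose

instance {P N : Mfd.{u}} {π : P → N} (hπ : Submersion π) : FiniteDimensional ℝ hπ.Compl :=
  hπ.exists_complement.choose_spec.choose_spec.choose_spec.choose

theorem Submersion.at {P N : Mfd.{u}} {π : P → N} (hπ : Submersion π) (p : P) :
    Manifold.IsSubmersionAtOfComplement hπ.Compl 𝓘(ℝ, P.model) 𝓘(ℝ, N.model) ∞ π p :=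
  hπ.exists_complement.choose_spec.choose_spec.choose_spec.choose_spec p

namespace Fib

open Manifold

variable {M N P : Mfd.{u}} {f : M → N} {π : P → N}

/-- The charts of the fibre product of a smooth map and a submersion. -/
noncomputable abbrev chartedSpace (hf : Smooth f) (hπ : Submersion π) :
    ChartedSpace (M.model × hπ.Compl) (Fib f π) where
  atlas := Set.range fun z : Fib f π => chart z.fst (hπ.at z.snd) hf.continuous z
  chartAt z := chart z.fst (hπ.at z.snd) hf.continuous z
  mem_chart_source z := ⟨mem_chart_source _ _, (hπ.at z.snd).mem_domChart_source⟩
  chart_mem_atlas z := ⟨z, rfl⟩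

variable {F : Type} [NormedAddCommGroup F] [NormedSpace ℝ F] (x : M) {p : P}
  (h : IsSubmersionAtOfComplement F 𝓘(ℝ, P.model) 𝓘(ℝ, N.model) ∞ π p)

theorem chart_symm_fst (hf : Continuous f) (z₀ : Fib f π) {w : M.model × F}
    (hw : w ∈ chartTarget f x h) :
    ((chart x h hf z₀).symm w).fst = (chartAt M.model x).symm w.1 := by
  classical exact congrArg fst (dif_pos hw)

theorem chart_symm_snd (hf : Continuous f) (z₀ : Fib f π) {w : M.model × F}
    (hw : w ∈ chartTarget f x h) :
    ((chart x h hf z₀).symm w).snd = invSnd f x h w := by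
  classical exact congrArg snd (dif_pos hw)

theorem contMDiffOn_invSnd (hf : Smooth f) :
    ContMDiffOn 𝓘(ℝ, M.model × F) 𝓘(ℝ, P.model) ∞ (invSnd f x h) (chartTarget f x h) := by
  have hfst : ContMDiff 𝓘(ℝ, M.model × F) 𝓘(ℝ, M.model) ∞ (Prod.fst : M.model × F → M.model) :=
    contDiff_fst.contMDiff
  have hsnd : ContMDiff 𝓘(ℝ, M.model × F) 𝓘(ℝ, F) ∞ (Prod.snd : M.model × F → F) :=
    contDiff_snd.contMDiff
  have h1 : ContMDiffOn 𝓘(ℝ, M.model × F) 𝓘(ℝ, N.model) ∞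
      (fun w : M.model × F => h.codChart (f ((chartAt M.model x).symm w.1)))
      (chartTarget f x h) := by
    refine (contMDiffOn_of_mem_maximalAtlas h.codChart_mem_maximalAtlas).comp
      (ContMDiff.comp_contMDiffOn hf ((contMDiffOn_symm_of_mem_maximalAtlas
        (IsManifold.chart_mem_maximalAtlas (I := 𝓘(ℝ, M.model)) (n := ∞) x)).comp
          hfst.contMDiffOn fun w hw => hw.1)) fun w hw => hw.2.1
  have h2 : ContMDiffOn 𝓘(ℝ, M.model × F) 𝓘(ℝ, N.model × F) ∞
      (fun w : M.model × F => (h.codChart (f ((chartAt M.model x).symm w.1)), w.2))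
      (chartTarget f x h) := h1.prodMk_space hsnd.contMDiffOn
  have h3 := h.equiv.symm.contDiff.contMDiff (n := ∞) |>.comp_contMDiffOn h2
  exact (contMDiffOn_symm_of_mem_maximalAtlas h.domChart_mem_maximalAtlas).comp h3
    fun w hw => hw.2.2

theorem contMDiffOn_chart_comp {E : Type} [NormedAddCommGroup E] [NormedSpace ℝ E]
    {A : Type*} [TopologicalSpace A] [ChartedSpace E A]
    {a : A → M} {b : A → P} {s : Set A}
    (ha : ContMDiffOn 𝓘(ℝ, E) 𝓘(ℝ, M.model) ∞ a s) (hb : ContMDiffOn 𝓘(ℝ, E) 𝓘(ℝ, P.model) ∞ b s)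
    (hsa : ∀ y ∈ s, a y ∈ (chartAt M.model x).source) (hsb : ∀ y ∈ s, b y ∈ h.domChart.source) :
    ContMDiffOn 𝓘(ℝ, E) 𝓘(ℝ, M.model × F) ∞
      (fun y => (chartAt M.model x (a y), (h.equiv (h.domChart (b y))).2)) s := by
  refine ContMDiffOn.prodMk_space ?_ ?_
  · exact (contMDiffOn_of_mem_maximalAtlas
      (IsManifold.chart_mem_maximalAtlas (I := 𝓘(ℝ, M.model)) (n := ∞) x)).comp ha hsa
  · exact ((contDiff_snd.comp h.equiv.contDiff).contMDiff (n := ∞)).comp_contMDiffOn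
      ((contMDiffOn_of_mem_maximalAtlas h.domChart_mem_maximalAtlas).comp hb hsb)

theorem isManifold (hf : Smooth f) (hπ : Submersion π) :
    let _ := chartedSpace hf hπ
    IsManifold 𝓘(ℝ, M.model × hπ.Compl) ∞ (Fib f π) := by
  intro _
  apply isManifold_of_contDiffOn
  rintro _ _ ⟨z, rfl⟩ ⟨z', rfl⟩
  have ht : ∀ w ∈ ((chart z.fst (hπ.at z.snd) hf.continuous z).symm ≫ₕ
      chart z'.fst (hπ.at z'.snd) hf.continuous z').source,
      w ∈ chartTarget f z.fst (hπ.at z.snd) := fun w hw => hw.1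
  have hs : ∀ w ∈ ((chart z.fst (hπ.at z.snd) hf.continuous z).symm ≫ₕ
      chart z'.fst (hπ.at z'.snd) hf.continuous z').source,
      (chart z.fst (hπ.at z.snd) hf.continuous z).symm w ∈
        (chart z'.fst (hπ.at z'.snd) hf.continuous z').source := fun w hw => hw.2
  simp only [modelWithCornersSelf_coe, modelWithCornersSelf_coe_symm, Set.range_id,
    Set.inter_univ, Set.preimage_id, Function.id_comp, Function.comp_id]
  rw [← contMDiffOn_iff_contDiffOn]
  refine contMDiffOn_chart_comp z'.fst (hπ.at z'.snd)
    (a := fun w => ((chart z.fst (hπ.at z.snd) hf.continuous z).symm w).fst)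
    (b := fun w => ((chart z.fst (hπ.at z.snd) hf.continuous z).symm w).snd)
    ?_ ?_ (fun w hw => (hs w hw).1) (fun w hw => (hs w hw).2)
  · exact ((contMDiffOn_symm_of_mem_maximalAtlas (IsManifold.chart_mem_maximalAtlas
      (I := 𝓘(ℝ, M.model)) (n := ∞) z.fst)).comp
        (contDiff_fst.contMDiff (n := ∞)).contMDiffOn fun w hw => (ht w hw).1).congr
      fun w hw => chart_symm_fst _ _ _ _ (ht w hw)
  · exact ((contMDiffOn_invSnd z.fst (hπ.at z.snd) hf).mono fun w hw => ht w hw).congr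
      fun w hw => chart_symm_snd _ _ _ _ (ht w hw)

theorem isSubmersion_fst (hf : Smooth f) (hπ : Submersion π) :
    let _ := chartedSpace hf hπ
    IsSubmersion 𝓘(ℝ, M.model × hπ.Compl) 𝓘(ℝ, M.model) ∞ (fst : Fib f π → M) := by
  intro _
  have : IsManifold 𝓘(ℝ, M.model × hπ.Compl) ∞ (Fib f π) := isManifold hf hπ
  refine IsSubmersionOfComplement.isSubmersion (F := hπ.Compl) fun z => ?_
  refine IsSubmersionAtOfComplement.mk_of_charts
    (ContinuousLinearEquiv.refl ℝ (M.model × hπ.Compl))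
    (chartAt (M.model × hπ.Compl) z) (chartAt M.model z.fst) (mem_chart_source _ _)
    (mem_chart_source _ _) (IsManifold.chart_mem_maximalAtlas z)
    (IsManifold.chart_mem_maximalAtlas z.fst) (fun y hy => hy.1) fun w hw => ?_
  have hw' : w ∈ chartTarget f z.fst (hπ.at z.snd) := by
    have h0 : w ∈ (chartAt (M.model × hπ.Compl) z).target := by
      simpa only [OpenPartialHomeomorph.extend_target, modelWithCornersSelf_coe,
        modelWithCornersSelf_coe_symm, Set.range_id, Set.inter_univ, Set.preimage_id] using hw
    exact h0
  change chartAt M.model z.fst ((chart z.fst (hπ.at z.snd) hf.continuous z).symm w).fst = w.1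
  rw [chart_symm_fst _ _ _ _ hw', (chartAt M.model z.fst).right_inv hw'.1]

theorem contMDiff_snd (hf : Smooth f) (hπ : Submersion π) :
    let _ := chartedSpace hf hπ
    ContMDiff 𝓘(ℝ, M.model × hπ.Compl) 𝓘(ℝ, P.model) ∞ (snd : Fib f π → P) := by
  intro _
  have : IsManifold 𝓘(ℝ, M.model × hπ.Compl) ∞ (Fib f π) := isManifold hf hπ
  intro z
  have h1 := contMDiffOn_of_mem_maximalAtlas
    (IsManifold.chart_mem_maximalAtlas (I := 𝓘(ℝ, M.model × hπ.Compl)) (n := ∞) z)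
  have h2 := (contMDiffOn_invSnd z.fst (hπ.at z.snd) hf).comp h1
    fun y hy => (chart z.fst (hπ.at z.snd) hf.continuous z).map_source hy
  refine (h2.congr fun y hy => ?_).contMDiffAt (chart_source_mem_nhds _ z)
  have hy' := (chart z.fst (hπ.at z.snd) hf.continuous z).map_source hy
  have := chart_symm_snd z.fst (hπ.at z.snd) hf.continuous z hy'
  rw [(chart z.fst (hπ.at z.snd) hf.continuous z).left_inv hy] at this
  exact this

theorem contMDiff_mk {Q : Mfd.{u}} {a : Q → M} {b : Q → P} (hf : Smooth f) (hπ : Submersion π)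
    (ha : Smooth a) (hb : Smooth b) (h : ∀ q, f (a q) = π (b q)) :
    let _ := chartedSpace hf hπ
    ContMDiff 𝓘(ℝ, Q.model) 𝓘(ℝ, M.model × hπ.Compl) ∞
      (fun q => (⟨a q, b q, h q⟩ : Fib f π)) := by
  intro _
  have : IsManifold 𝓘(ℝ, M.model × hπ.Compl) ∞ (Fib f π) := isManifold hf hπ
  intro q
  have hc : Continuous (fun q => (⟨a q, b q, h q⟩ : Fib f π)) :=
    isInducing_toProd.continuous_iff.2 (ha.continuous.prodMk hb.continuous)
  rw [contMDiffAt_iff_target]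
  refine ⟨hc.continuousAt, ?_⟩
  have hs : IsOpen ((fun q => (⟨a q, b q, h q⟩ : Fib f π)) ⁻¹'
      (chart (a q) (hπ.at (b q)) hf.continuous ⟨a q, b q, h q⟩).source) :=
    (chart (a q) (hπ.at (b q)) hf.continuous ⟨a q, b q, h q⟩).open_source.preimage hc
  exact (contMDiffOn_chart_comp (a q) (hπ.at (b q)) ha.contMDiffOn hb.contMDiffOn
    (fun y hy => hy.1) fun y hy => hy.2).contMDiffAt (hs.mem_nhds
      ⟨mem_chart_source _ _, (hπ.at (b q)).mem_domChart_source⟩)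

end Fib

/-- The fibre product `M ×_N P` of a smooth map `f : M → N` and a submersion `π : P → N`. -/
noncomputable def fibProd {M N P : Mfd.{u}} (f : M → N) (hf : Smooth f) (π : P → N)
    (hπ : Submersion π) : Mfd.{u} :=
  letI := Fib.chartedSpace hf hπ
  { carrier := Fib f π
    model := M.model × hπ.Compl
    isManifold := Fib.isManifold hf hπ }

section

open Manifold

variable {M N P Q : Mfd.{u}} {f : M → N} {hf : Smooth f} {π : P → N} {hπ : Submersion π}

/-- The first projection of a fibre product. -/
def pr₁ (z : fibProd f hf π hπ) : M := Fib.fst (f := f) (π := π) z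

/-- The second projection of a fibre product. -/
def pr₂ (z : fibProd f hf π hπ) : P := Fib.snd (f := f) (π := π) z

theorem pr_w (z : fibProd f hf π hπ) : f (pr₁ z) = π (pr₂ z) := Fib.w (f := f) (π := π) z

/-- The point `(m, p)` of a fibre product. -/
def pair (m : M) (p : P) (h : f m = π p) : fibProd f hf π hπ := Fib.mk (f := f) (π := π) m p h

@[simp] theorem pr₁_pair (m : M) (p : P) (h : f m = π p) :
    pr₁ (pair m p h : fibProd f hf π hπ) = m := rfl

@[simp] theorem pr₂_pair (m : M) (p : P) (h : f m = π p) :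
    pr₂ (pair m p h : fibProd f hf π hπ) = p := rfl

theorem fibProd_ext {z z' : fibProd f hf π hπ} (h1 : pr₁ z = pr₁ z') (h2 : pr₂ z = pr₂ z') :
    z = z' := Fib.ext (f := f) (π := π) h1 h2

theorem submersion_pr₁ : Submersion (pr₁ : fibProd f hf π hπ → M) := Fib.isSubmersion_fst hf hπ

theorem smooth_pr₁ : Smooth (pr₁ : fibProd f hf π hπ → M) := submersion_pr₁.smooth

theorem smooth_pr₂ : Smooth (pr₂ : fibProd f hf π hπ → P) := Fib.contMDiff_snd hf hπ

theorem smooth_pair {a : Q → M} {b : Q → P} (ha : Smooth a) (hb : Smooth b)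
    (h : ∀ q, f (a q) = π (b q)) : Smooth fun q => (pair (a q) (b q) (h q) : fibProd f hf π hπ) :=
  Fib.contMDiff_mk hf hπ ha hb h

end

end Mfd

/-- A Lie groupoid. An arrow `g` goes from `src g` to `tgt g`, and the product `mul g₁ g₂` (first
`g₂`, then `g₁`) is defined when `src g₁ = tgt g₂`. -/
structure LieGroupoid : Type (u + 1) where
  Obj : Mfd.{u}
  Arr : Mfd.{u}
  src : Arr → Obj
  tgt : Arr → Obj
  unit : Obj → Arr
  inv : Arr → Arr
  mul (g₁ g₂ : Arr) (h : src g₁ = tgt g₂) : Arr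
  submersion_src : Mfd.Submersion src
  submersion_tgt : Mfd.Submersion tgt
  smooth_unit : Mfd.Smooth unit
  smooth_inv : Mfd.Smooth inv
  smooth_mul : Mfd.Smooth fun z : Mfd.fibProd src submersion_src.smooth tgt submersion_tgt =>
    mul (Mfd.pr₁ z) (Mfd.pr₂ z) (Mfd.pr_w z)
  src_mul : ∀ g₁ g₂ h, src (mul g₁ g₂ h) = src g₂
  tgt_mul : ∀ g₁ g₂ h, tgt (mul g₁ g₂ h) = tgt g₁
  src_unit : ∀ x, src (unit x) = x
  tgt_unit : ∀ x, tgt (unit x) = x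
  src_inv : ∀ g, src (inv g) = tgt g
  tgt_inv : ∀ g, tgt (inv g) = src g
  mul_assoc : ∀ (g₁ g₂ g₃ : Arr) (h₁ : src g₁ = tgt g₂) (h₂ : src g₂ = tgt g₃),
    mul (mul g₁ g₂ h₁) g₃ ((src_mul g₁ g₂ h₁).trans h₂) =
      mul g₁ (mul g₂ g₃ h₂) (h₁.trans (tgt_mul g₂ g₃ h₂).symm)
  unit_mul : ∀ g, mul (unit (tgt g)) g (src_unit (tgt g)) = g
  mul_unit : ∀ g, mul g (unit (src g)) (tgt_unit (src g)).symm = g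
  inv_mul : ∀ g, mul (inv g) g (src_inv g) = unit (src g)
  mul_inv : ∀ g, mul g (inv g) (tgt_inv g).symm = unit (tgt g)

/-- The manifold `𝒢₂` of composable pairs `(g₁, g₂)`, `src g₁ = tgt g₂`. -/
noncomputable def LieGroupoid.Comp (𝒢 : LieGroupoid.{u}) : Mfd.{u} :=
  Mfd.fibProd 𝒢.src 𝒢.submersion_src.smooth 𝒢.tgt 𝒢.submersion_tgt

/-- The multiplication `𝒢₂ → 𝒢`. -/
def LieGroupoid.μ (𝒢 : LieGroupoid.{u}) (z : 𝒢.Comp) : 𝒢.Arr :=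
  𝒢.mul (Mfd.pr₁ z) (Mfd.pr₂ z) (Mfd.pr_w z)

/-- The projection `𝒢₂ → 𝒢` onto the first factor. -/
def LieGroupoid.p₁ (𝒢 : LieGroupoid.{u}) (z : 𝒢.Comp) : 𝒢.Arr := Mfd.pr₁ z

/-- The projection `𝒢₂ → 𝒢` onto the second factor. -/
def LieGroupoid.p₂ (𝒢 : LieGroupoid.{u}) (z : 𝒢.Comp) : 𝒢.Arr := Mfd.pr₂ z

theorem LieGroupoid.smooth_μ (𝒢 : LieGroupoid.{u}) : Mfd.Smooth 𝒢.μ := 𝒢.smooth_mul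

theorem LieGroupoid.smooth_p₁ (𝒢 : LieGroupoid.{u}) : Mfd.Smooth 𝒢.p₁ := Mfd.smooth_pr₁

theorem LieGroupoid.smooth_p₂ (𝒢 : LieGroupoid.{u}) : Mfd.Smooth 𝒢.p₂ := Mfd.smooth_pr₂

theorem LieGroupoid.smooth_src (𝒢 : LieGroupoid.{u}) : Mfd.Smooth 𝒢.src := 𝒢.submersion_src.smooth

theorem LieGroupoid.smooth_tgt (𝒢 : LieGroupoid.{u}) : Mfd.Smooth 𝒢.tgt := 𝒢.submersion_tgt.smooth

/-- A right principal `ℋ`-bundle over `M`: a manifold `total` with a surjective submersion `proj`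
onto `M` and a right action of `ℋ` with momentum `momentum`, such that `proj` is `ℋ`-invariant and
`(p, h) ↦ (p, p h)` is a diffeomorphism from `total ×_momentum ℋ` onto `total ×_M total`. -/
structure PrincipalBundle (ℋ : LieGroupoid.{u}) (M : Mfd.{u}) : Type (u + 1) where
  total : Mfd.{u}
  proj : total → M
  momentum : total → ℋ.Obj
  act (p : total) (h : ℋ.Arr) (w : momentum p = ℋ.tgt h) : total
  submersion_proj : Mfd.Submersion proj
  surjective_proj : Function.Surjective proj
  smooth_momentum : Mfd.Smooth momentum
  smooth_act : Mfd.Smooth fun z : Mfd.fibProd momentum smooth_momentum ℋ.tgt ℋ.submersion_tgt =>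
    act (Mfd.pr₁ z) (Mfd.pr₂ z) (Mfd.pr_w z)
  momentum_act : ∀ p h w, momentum (act p h w) = ℋ.src h
  act_unit : ∀ p, act p (ℋ.unit (momentum p)) (ℋ.tgt_unit _).symm = p
  act_mul : ∀ (p : total) (h₁ h₂ : ℋ.Arr) (w₁ : momentum p = ℋ.tgt h₁) (w₂ : ℋ.src h₁ = ℋ.tgt h₂),
    act p (ℋ.mul h₁ h₂ w₂) (w₁.trans (ℋ.tgt_mul h₁ h₂ w₂).symm) =
      act (act p h₁ w₁) h₂ ((momentum_act p h₁ w₁).trans w₂)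
  proj_act : ∀ p h w, proj (act p h w) = proj p
  shear : ∃ Φ : Diffeomorph
      𝓘(ℝ, (Mfd.fibProd momentum smooth_momentum ℋ.tgt ℋ.submersion_tgt).model)
      𝓘(ℝ, (Mfd.fibProd proj submersion_proj.smooth proj submersion_proj).model)
      (Mfd.fibProd momentum smooth_momentum ℋ.tgt ℋ.submersion_tgt)
      (Mfd.fibProd proj submersion_proj.smooth proj submersion_proj) ∞,
    ∀ z, Φ z = Mfd.pair (Mfd.pr₁ z) (act (Mfd.pr₁ z) (Mfd.pr₂ z) (Mfd.pr_w z))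
      (proj_act (Mfd.pr₁ z) (Mfd.pr₂ z) (Mfd.pr_w z)).symm

namespace PrincipalBundle

variable {ℋ : LieGroupoid.{u}} {M N L L' : Mfd.{u}}

/-- A morphism of principal `ℋ`-bundles over `M`: a smooth map over `M`, compatible with the momenta
and `ℋ`-equivariant. -/
@[ext]
structure Hom (P Q : PrincipalBundle ℋ M) : Type u where
  toFun : P.total → Q.total
  smooth : Mfd.Smooth toFun
  proj : ∀ p, Q.proj (toFun p) = P.proj p
  momentum : ∀ p, Q.momentum (toFun p) = P.momentum p
  act : ∀ p h w, toFun (P.act p h w) = Q.act (toFun p) h ((momentum p).trans w)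

/-- Composition of bundle morphisms, `f` after `g`. -/
def Hom.comp {P Q R : PrincipalBundle ℋ M} (f : Hom Q R) (g : Hom P Q) : Hom P R where
  toFun p := f.toFun (g.toFun p)
  smooth := ContMDiff.comp f.smooth g.smooth
  proj p := (f.proj _).trans (g.proj p)
  momentum p := (f.momentum _).trans (g.momentum p)
  act p h w := by rw [g.act, f.act]

theorem exists_div (P : PrincipalBundle ℋ M) :
    ∃ d : Mfd.fibProd P.proj P.submersion_proj.smooth P.proj P.submersion_proj → ℋ.Arr,
      Mfd.Smooth d ∧ ∀ z, ∃ w : P.momentum (Mfd.pr₁ z) = ℋ.tgt (d z),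
        P.act (Mfd.pr₁ z) (d z) w = Mfd.pr₂ z := by
  obtain ⟨Φ, hΦ⟩ := P.shear
  refine ⟨fun z => Mfd.pr₂ (Φ.symm z), ContMDiff.comp Mfd.smooth_pr₂ Φ.symm.contMDiff, fun z => ?_⟩
  have h := hΦ (Φ.symm z)
  rw [Φ.apply_symm_apply] at h
  have h1 := congrArg Mfd.pr₁ h
  have h2 := congrArg Mfd.pr₂ h
  rw [Mfd.pr₁_pair] at h1
  rw [Mfd.pr₂_pair] at h2
  have w := Mfd.pr_w (Φ.symm z)
  rw [← h1] at w
  refine ⟨w, ?_⟩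
  rw [h2]
  simp only [h1]

theorem act_injective (P : PrincipalBundle ℋ M) {p : P.total} {h h' : ℋ.Arr}
    (w : P.momentum p = ℋ.tgt h) (w' : P.momentum p = ℋ.tgt h') (e : P.act p h w = P.act p h' w') :
    h = h' := by
  obtain ⟨Φ, hΦ⟩ := P.shear
  have : Φ (Mfd.pair p h w) = Φ (Mfd.pair p h' w') := by
    rw [hΦ, hΦ]
    exact Mfd.fibProd_ext rfl e
  exact congrArg Mfd.pr₂ (Φ.injective this)

/-- The pull-back `f^* P = {(n, p) | f n = proj p}`, with action `(n, p) h = (n, p h)`. -/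
noncomputable def pullback (P : PrincipalBundle ℋ M) (f : N → M) (hf : Mfd.Smooth f) :
    PrincipalBundle ℋ N where
  total := Mfd.fibProd f hf P.proj P.submersion_proj
  proj := Mfd.pr₁
  momentum z := P.momentum (Mfd.pr₂ z)
  act z h w := Mfd.pair (Mfd.pr₁ z) (P.act (Mfd.pr₂ z) h w) ((Mfd.pr_w z).trans (P.proj_act _ _ _).symm)
  submersion_proj := Mfd.submersion_pr₁
  surjective_proj n := by
    obtain ⟨p, hp⟩ := P.surjective_proj (f n)
    exact ⟨Mfd.pair n p hp.symm, rfl⟩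
  smooth_momentum := ContMDiff.comp P.smooth_momentum Mfd.smooth_pr₂
  smooth_act := Mfd.smooth_pair (ContMDiff.comp Mfd.smooth_pr₁ Mfd.smooth_pr₁)
    (ContMDiff.comp P.smooth_act
      (Mfd.smooth_pair (ContMDiff.comp Mfd.smooth_pr₂ Mfd.smooth_pr₁) Mfd.smooth_pr₂
        fun z => Mfd.pr_w z)) _
  momentum_act _ _ _ := P.momentum_act _ _ _
  act_unit _ := Mfd.fibProd_ext rfl (P.act_unit _)
  act_mul _ _ _ _ _ := Mfd.fibProd_ext rfl (P.act_mul _ _ _ _ _)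
  proj_act _ _ _ := rfl
  shear := by
    obtain ⟨d, hd, hd'⟩ := P.exists_div
    choose w hw using hd'
    let D : Mfd.fibProd (Mfd.pr₁ (f := f) (hf := hf) (π := P.proj) (hπ := P.submersion_proj))
        Mfd.smooth_pr₁ (Mfd.pr₁ (f := f) (hf := hf) (π := P.proj) (hπ := P.submersion_proj))
        Mfd.submersion_pr₁ →
        Mfd.fibProd P.proj P.submersion_proj.smooth P.proj P.submersion_proj := fun z =>
      Mfd.pair (Mfd.pr₂ (Mfd.pr₁ z)) (Mfd.pr₂ (Mfd.pr₂ z))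
        ((Mfd.pr_w (Mfd.pr₁ z)).symm.trans
          ((congrArg f (Mfd.pr_w z)).trans (Mfd.pr_w (Mfd.pr₂ z))))
    have hD : Mfd.Smooth D := Mfd.smooth_pair (ContMDiff.comp Mfd.smooth_pr₂ Mfd.smooth_pr₁)
      (ContMDiff.comp Mfd.smooth_pr₂ Mfd.smooth_pr₂) _
    refine ⟨⟨⟨fun z => Mfd.pair (Mfd.pr₁ z) (Mfd.pair (Mfd.pr₁ (Mfd.pr₁ z))
        (P.act (Mfd.pr₂ (Mfd.pr₁ z)) (Mfd.pr₂ z) (Mfd.pr_w z))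
          ((Mfd.pr_w _).trans (P.proj_act _ _ _).symm)) rfl,
      fun z => Mfd.pair (Mfd.pr₁ z) (d (D z)) (w (D z)), fun z => ?_, fun z => ?_⟩, ?_, ?_⟩,
      fun z => rfl⟩
    · refine Mfd.fibProd_ext rfl ?_
      exact P.act_injective _ _ (hw (D (Mfd.pair (Mfd.pr₁ z) (Mfd.pair (Mfd.pr₁ (Mfd.pr₁ z))
        (P.act (Mfd.pr₂ (Mfd.pr₁ z)) (Mfd.pr₂ z) (Mfd.pr_w z))
          ((Mfd.pr_w _).trans (P.proj_act _ _ _).symm)) rfl)))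
    · exact Mfd.fibProd_ext rfl (Mfd.fibProd_ext (Mfd.pr_w z) (hw (D z)))
    · exact Mfd.smooth_pair Mfd.smooth_pr₁ (Mfd.smooth_pair
        (ContMDiff.comp Mfd.smooth_pr₁ Mfd.smooth_pr₁) (ContMDiff.comp P.smooth_act
          (Mfd.smooth_pair (ContMDiff.comp Mfd.smooth_pr₂ Mfd.smooth_pr₁) Mfd.smooth_pr₂
            fun z => Mfd.pr_w z)) _) _
    · exact Mfd.smooth_pair Mfd.smooth_pr₁ (ContMDiff.comp hd hD) _

/-- The pull-back `f^* Θ`, given by `(n, p) ↦ (n, Θ p)`. -/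
noncomputable def Hom.pullback {P Q : PrincipalBundle ℋ M} (Θ : Hom P Q) (f : N → M)
    (hf : Mfd.Smooth f) : Hom (P.pullback f hf) (Q.pullback f hf) where
  toFun z := Mfd.pair (Mfd.pr₁ z) (Θ.toFun (Mfd.pr₂ z)) ((Mfd.pr_w z).trans (Θ.proj _).symm)
  smooth := Mfd.smooth_pair Mfd.smooth_pr₁ (ContMDiff.comp Θ.smooth Mfd.smooth_pr₂) _
  proj _ := rfl
  momentum z := Θ.momentum (Mfd.pr₂ z)
  act _ _ _ := Mfd.fibProd_ext rfl (Θ.act _ _ _)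

/-- The canonical identification `g₁^* f₁^* P = g₂^* f₂^* P` when `f₁ ∘ g₁ = f₂ ∘ g₂`, given by
`(x, (g₁ x, p)) ↦ (x, (g₂ x, p))`. -/
noncomputable def pullbackCongr (P : PrincipalBundle ℋ M) {f₁ : N → M} (hf₁ : Mfd.Smooth f₁)
    {g₁ : L → N} (hg₁ : Mfd.Smooth g₁) {f₂ : L' → M} (hf₂ : Mfd.Smooth f₂) {g₂ : L → L'}
    (hg₂ : Mfd.Smooth g₂) (e : ∀ x, f₁ (g₁ x) = f₂ (g₂ x)) :
    Hom ((P.pullback f₁ hf₁).pullback g₁ hg₁) ((P.pullback f₂ hf₂).pullback g₂ hg₂) where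
  toFun z := Mfd.pair (Mfd.pr₁ z) (Mfd.pair (g₂ (Mfd.pr₁ z)) (Mfd.pr₂ (Mfd.pr₂ z))
    ((e _).symm.trans ((congrArg f₁ (Mfd.pr_w z)).trans (Mfd.pr_w (Mfd.pr₂ z))))) rfl
  smooth := Mfd.smooth_pair Mfd.smooth_pr₁ (Mfd.smooth_pair (ContMDiff.comp hg₂ Mfd.smooth_pr₁)
    (ContMDiff.comp Mfd.smooth_pr₂ Mfd.smooth_pr₂) _) _
  proj _ := rfl
  momentum _ := rfl
  act _ _ _ := rfl

end PrincipalBundle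

/-- A generalized morphism from `𝒢` to `ℋ`: a principal `ℋ`-bundle over the objects of `𝒢` with a
left action of `𝒢` along the bundle projection, which leaves the momentum invariant and commutes
with the right action of `ℋ`. -/
structure GenMor (𝒢 ℋ : LieGroupoid.{u}) : Type (u + 1) where
  bundle : PrincipalBundle ℋ 𝒢.Obj
  lact (g : 𝒢.Arr) (p : bundle.total) (w : 𝒢.src g = bundle.proj p) : bundle.total
  smooth_lact : Mfd.Smooth
    fun z : Mfd.fibProd 𝒢.src 𝒢.smooth_src bundle.proj bundle.submersion_proj =>
      lact (Mfd.pr₁ z) (Mfd.pr₂ z) (Mfd.pr_w z)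
  proj_lact : ∀ g p w, bundle.proj (lact g p w) = 𝒢.tgt g
  unit_lact : ∀ p, lact (𝒢.unit (bundle.proj p)) p (𝒢.src_unit _) = p
  mul_lact : ∀ (g₁ g₂ : 𝒢.Arr) (p : bundle.total) (w₁ : 𝒢.src g₁ = 𝒢.tgt g₂)
    (w₂ : 𝒢.src g₂ = bundle.proj p),
    lact (𝒢.mul g₁ g₂ w₁) p ((𝒢.src_mul g₁ g₂ w₁).trans w₂) =
      lact g₁ (lact g₂ p w₂) (w₁.trans (proj_lact g₂ p w₂).symm)
  momentum_lact : ∀ g p w, bundle.momentum (lact g p w) = bundle.momentum p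
  lact_act : ∀ (g : 𝒢.Arr) (p : bundle.total) (h : ℋ.Arr) (w : 𝒢.src g = bundle.proj p)
    (w' : bundle.momentum p = ℋ.tgt h),
    lact g (bundle.act p h w') (w.trans (bundle.proj_act p h w').symm) =
      bundle.act (lact g p w) h ((momentum_lact g p w).trans w')

/-- Two generalized morphisms are equivalent if there is a morphism of principal bundles between
them that commutes with the left actions. All morphisms of principal bundles over the same base are
invertible, so that this is an equivalence relation. -/
def GenMor.Equivalent {𝒢 ℋ : LieGroupoid.{u}} (P Q : GenMor 𝒢 ℋ) : Prop :=
  ∃ S : PrincipalBundle.Hom P.bundle Q.bundle, ∀ g p w,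
    S.toFun (P.lact g p w) = Q.lact g (S.toFun p) (w.trans (S.proj p).symm)

/-- Equivalence classes of generalized morphisms. -/
def GenMorClass (𝒢 ℋ : LieGroupoid.{u}) : Type (u + 1) :=
  Quot (GenMor.Equivalent (𝒢 := 𝒢) (ℋ := ℋ))

/-- The compatibility condition `μ^* Θ = pr₁^* Θ ∘ pr₂^* Θ` over `𝒢₂` for a morphism
`Θ : s^* P → t^* P`, through the canonical identifications `μ^* s^* P = pr₂^* s^* P`,
`pr₂^* t^* P = pr₁^* s^* P` and `pr₁^* t^* P = μ^* t^* P`. -/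
def IsCompatible {𝒢 ℋ : LieGroupoid.{u}} {P : PrincipalBundle ℋ 𝒢.Obj}
    (Θ : (P.pullback 𝒢.src 𝒢.smooth_src).Hom (P.pullback 𝒢.tgt 𝒢.smooth_tgt)) : Prop :=
  Θ.pullback 𝒢.μ 𝒢.smooth_μ =
    (P.pullbackCongr 𝒢.smooth_tgt 𝒢.smooth_p₁ 𝒢.smooth_tgt 𝒢.smooth_μ
      fun _ => (𝒢.tgt_mul _ _ _).symm).comp
    ((Θ.pullback 𝒢.p₁ 𝒢.smooth_p₁).comp
    ((P.pullbackCongr 𝒢.smooth_tgt 𝒢.smooth_p₂ 𝒢.smooth_src 𝒢.smooth_p₁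
      fun z => (Mfd.pr_w z).symm).comp
    ((Θ.pullback 𝒢.p₂ 𝒢.smooth_p₂).comp
    (P.pullbackCongr 𝒢.smooth_src 𝒢.smooth_μ 𝒢.smooth_src 𝒢.smooth_p₂
      fun _ => 𝒢.src_mul _ _ _))))

/-- A principal `ℋ`-bundle `P` over the objects of `𝒢` with a morphism `Θ : s^* P → t^* P` that
satisfies the compatibility condition over `𝒢₂`. -/
structure DescentDatum (𝒢 ℋ : LieGroupoid.{u}) : Type (u + 1) where
  bundle : PrincipalBundle ℋ 𝒢.Obj
  Θ : (bundle.pullback 𝒢.src 𝒢.smooth_src).Hom (bundle.pullback 𝒢.tgt 𝒢.smooth_tgt)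
  compatible : IsCompatible Θ

/-- Two pairs `(P, Θ)` and `(Q, Η)` are equivalent if there is a morphism `Σ : P → Q` such that
`t^* Σ ∘ Θ = Η ∘ s^* Σ`. -/
def DescentDatum.Equivalent {𝒢 ℋ : LieGroupoid.{u}} (D E : DescentDatum 𝒢 ℋ) : Prop :=
  ∃ S : PrincipalBundle.Hom D.bundle E.bundle,
    (S.pullback 𝒢.tgt 𝒢.smooth_tgt).comp D.Θ = E.Θ.comp (S.pullback 𝒢.src 𝒢.smooth_src)

/-- Equivalence classes of pairs `(P, Θ)`: isomorphism classes of principal bundles together with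
equivalence classes of compatible morphisms. -/
def DescentClass (𝒢 ℋ : LieGroupoid.{u}) : Type (u + 1) :=
  Quot (DescentDatum.Equivalent (𝒢 := 𝒢) (ℋ := ℋ))

namespace LieGroupoid

variable (𝒢 : LieGroupoid.{u})

/-- The manifold `𝒢ₙ` of composable `n`-tuples of arrows, with the map `(g₁, …, gₙ) ↦ tgt g₁`. A
point of `𝒢ₙ₊₁` is a pair of `(g₂, …, gₙ₊₁)` in `𝒢ₙ` and `g₁` with `src g₁ = tgt g₂`; for `n = 0`
it is a pair of `x` in `𝒢₀ = Obj` and `g₁` with `src g₁ = x`. -/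
noncomputable def nerveAux : ℕ → (N : Mfd.{u}) × {v : N → 𝒢.Obj // Mfd.Smooth v}
  | 0 => ⟨𝒢.Obj, id, contMDiff_id⟩
  | n + 1 => ⟨Mfd.fibProd (nerveAux n).2.1 (nerveAux n).2.2 𝒢.src 𝒢.submersion_src,
      fun z => 𝒢.tgt (Mfd.pr₂ z), ContMDiff.comp 𝒢.smooth_tgt Mfd.smooth_pr₂⟩

/-- The manifold `𝒢ₙ` of composable `n`-tuples of arrows. -/
noncomputable def nerve (n : ℕ) : Mfd.{u} := (𝒢.nerveAux n).1

/-- The first vertex, `(g₁, …, gₙ) ↦ tgt g₁`. -/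
noncomputable def headVertex (n : ℕ) (y : 𝒢.nerve n) : 𝒢.Obj := (𝒢.nerveAux n).2.1 y

theorem smooth_headVertex (n : ℕ) : Mfd.Smooth (𝒢.headVertex n) := (𝒢.nerveAux n).2.2

/-- The last `n` arrows `(g₂, …, gₙ₊₁)` (for `n = 0`: the source of `g₁`). -/
noncomputable def tail (n : ℕ) (y : 𝒢.nerve (n + 1)) : 𝒢.nerve n :=
  Mfd.pr₁ (f := 𝒢.headVertex n) (hf := 𝒢.smooth_headVertex n) (hπ := 𝒢.submersion_src) y

/-- The first arrow `g₁`. -/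
noncomputable def headArrow (n : ℕ) (y : 𝒢.nerve (n + 1)) : 𝒢.Arr :=
  Mfd.pr₂ (f := 𝒢.headVertex n) (hf := 𝒢.smooth_headVertex n) (hπ := 𝒢.submersion_src) y

/-- The tuple `(g₁, …, gₙ₊₁)` from `(g₂, …, gₙ₊₁)` and `g₁`. -/
noncomputable def cons (n : ℕ) (y : 𝒢.nerve n) (g : 𝒢.Arr) (h : 𝒢.headVertex n y = 𝒢.src g) :
    𝒢.nerve (n + 1) :=
  Mfd.pair (f := 𝒢.headVertex n) (hf := 𝒢.smooth_headVertex n) (hπ := 𝒢.submersion_src) y g h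

theorem smooth_tail (n : ℕ) : Mfd.Smooth (𝒢.tail n) := Mfd.smooth_pr₁

theorem smooth_headArrow (n : ℕ) : Mfd.Smooth (𝒢.headArrow n) := Mfd.smooth_pr₂

theorem smooth_cons {Q : Mfd.{u}} {n : ℕ} {a : Q → 𝒢.nerve n} {b : Q → 𝒢.Arr} (ha : Mfd.Smooth a)
    (hb : Mfd.Smooth b) (h : ∀ q, 𝒢.headVertex n (a q) = 𝒢.src (b q)) :
    Mfd.Smooth fun q => 𝒢.cons n (a q) (b q) (h q) := Mfd.smooth_pair ha hb h

theorem headVertex_tail (n : ℕ) (y : 𝒢.nerve (n + 1)) :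
    𝒢.headVertex n (𝒢.tail n y) = 𝒢.src (𝒢.headArrow n y) :=
  Mfd.pr_w (f := 𝒢.headVertex n) (hf := 𝒢.smooth_headVertex n) (hπ := 𝒢.submersion_src) y

theorem headVertex_succ (n : ℕ) (y : 𝒢.nerve (n + 1)) :
    𝒢.headVertex (n + 1) y = 𝒢.tgt (𝒢.headArrow n y) := rfl

/-- The vertices `(tgt g₁, src g₁ = tgt g₂, …, src gₙ)` of `(g₁, …, gₙ)`. -/
noncomputable def vertex : (n : ℕ) → 𝒢.nerve n → Fin (n + 1) → 𝒢.Obj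
  | 0, x => fun _ => x
  | n + 1, y => Fin.cons (𝒢.tgt (𝒢.headArrow n y)) (vertex n (𝒢.tail n y))

theorem continuous_vertex (n : ℕ) (i : Fin (n + 1)) : Continuous fun y => 𝒢.vertex n y i := by
  induction n with
  | zero => exact continuous_id
  | succ n ih =>
    refine Fin.cases ?_ (fun j => ?_) i
    · exact 𝒢.smooth_tgt.continuous.comp (𝒢.smooth_headArrow n).continuous
    · exact (ih j).comp (𝒢.smooth_tail n).continuous

theorem vertex_zero (n : ℕ) (y : 𝒢.nerve n) : 𝒢.vertex n y 0 = 𝒢.headVertex n y := by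
  cases n <;> rfl

/-- Composition of the first two arrows, `(g₁, g₂, …) ↦ (g₁ g₂, …)`. -/
noncomputable def mulHead (n : ℕ) (y : 𝒢.nerve (n + 2)) : 𝒢.nerve (n + 1) :=
  𝒢.cons n (𝒢.tail n (𝒢.tail (n + 1) y))
    (𝒢.mul (𝒢.headArrow (n + 1) y) (𝒢.headArrow n (𝒢.tail (n + 1) y))
      (𝒢.headVertex_tail (n + 1) y).symm)
    ((𝒢.headVertex_tail n (𝒢.tail (n + 1) y)).trans (𝒢.src_mul _ _ _).symm)

theorem smooth_mulHead (n : ℕ) : Mfd.Smooth (𝒢.mulHead n) :=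
  𝒢.smooth_cons (ContMDiff.comp (𝒢.smooth_tail n) (𝒢.smooth_tail (n + 1)))
    (ContMDiff.comp 𝒢.smooth_mul (Mfd.smooth_pair (𝒢.smooth_headArrow (n + 1))
      (ContMDiff.comp (𝒢.smooth_headArrow n) (𝒢.smooth_tail (n + 1)))
      fun y => (𝒢.headVertex_tail (n + 1) y).symm)) _

/-- The face maps `𝒢ₙ₊₁ → 𝒢ₙ` that drop a vertex other than the first one. -/
noncomputable def faceSucc : (n : ℕ) → Fin (n + 1) →
    {f : 𝒢.nerve (n + 1) → 𝒢.nerve n //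
      Mfd.Smooth f ∧ ∀ y, 𝒢.headVertex n (f y) = 𝒢.headVertex (n + 1) y}
  | 0, _ => ⟨fun y => 𝒢.tgt (𝒢.headArrow 0 y),
      ContMDiff.comp 𝒢.smooth_tgt (𝒢.smooth_headArrow 0), fun _ => rfl⟩
  | n + 1, k => Fin.cases
      ⟨𝒢.mulHead n, 𝒢.smooth_mulHead n, fun _ => 𝒢.tgt_mul _ _ _⟩
      (fun k' => ⟨fun y => 𝒢.cons n ((faceSucc n k').1 (𝒢.tail (n + 1) y)) (𝒢.headArrow (n + 1) y)
          (((faceSucc n k').2.2 _).trans (𝒢.headVertex_tail (n + 1) y)),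
        𝒢.smooth_cons (ContMDiff.comp (faceSucc n k').2.1 (𝒢.smooth_tail (n + 1)))
          (𝒢.smooth_headArrow (n + 1)) _, fun _ => rfl⟩) k

/-- The face maps `𝒢ₙ₊₁ → 𝒢ₙ`; the `k`-th one drops the `k`-th vertex: for `k = 0` it drops `g₁`,
for `k = n + 1` it drops `gₙ₊₁`, otherwise it composes `gₖ` and `gₖ₊₁`. -/
noncomputable def face (n : ℕ) (k : Fin (n + 2)) : 𝒢.nerve (n + 1) → 𝒢.nerve n :=
  Fin.cases (𝒢.tail n) (fun k' => (𝒢.faceSucc n k').1) k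

theorem smooth_face (n : ℕ) (k : Fin (n + 2)) : Mfd.Smooth (𝒢.face n k) :=
  Fin.cases (𝒢.smooth_tail n) (fun k' => (𝒢.faceSucc n k').2.1) k

theorem vertex_faceSucc (n : ℕ) (k : Fin (n + 1)) (y : 𝒢.nerve (n + 1)) (i : Fin (n + 1)) :
    𝒢.vertex n ((𝒢.faceSucc n k).1 y) i = 𝒢.vertex (n + 1) y (k.succ.succAbove i) := by
  induction n with
  | zero =>
    obtain rfl := Fin.fin_one_eq_zero i
    obtain rfl := Fin.fin_one_eq_zero k
    rfl
  | succ n ih =>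
    refine Fin.cases ?_ (fun k' => ?_) k
    · refine Fin.cases ?_ (fun j => ?_) i
      · exact 𝒢.tgt_mul _ _ _
      · rfl
    · refine Fin.cases rfl (fun j => ?_) i
      rw [Fin.succ_succAbove_succ]
      exact ih k' (𝒢.tail (n + 1) y) j

theorem vertex_face (n : ℕ) (k : Fin (n + 2)) (y : 𝒢.nerve (n + 1)) (i : Fin (n + 1)) :
    𝒢.vertex n (𝒢.face n k y) i = 𝒢.vertex (n + 1) y (k.succAbove i) := by
  refine Fin.cases ?_ (fun k => 𝒢.vertex_faceSucc n k y i) k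
  rw [Fin.succAbove_zero]
  rfl

end LieGroupoid

/-- An open covering of a manifold. -/
structure Cover (M : Mfd.{u}) : Type (u + 1) where
  ι : Type u
  sets : ι → Opens M
  covers : ∀ x, ∃ i, x ∈ sets i

/-- A `1`-cocycle on an open covering with values in the sheaf of smooth maps to `ℋ`. -/
structure Cocycle {M : Mfd.{u}} (U : Cover M) (ℋ : LieGroupoid.{u}) : Type u where
  ε (i : U.ι) : U.sets i → ℋ.Obj
  Φ (i j : U.ι) : (U.sets i ⊓ U.sets j : Opens M) → ℋ.Arr
  smooth_ε : ∀ i, ContMDiff 𝓘(ℝ, M.model) 𝓘(ℝ, ℋ.Obj.model) ∞ (ε i)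
  smooth_Φ : ∀ i j, ContMDiff 𝓘(ℝ, M.model) 𝓘(ℝ, ℋ.Arr.model) ∞ (Φ i j)
  tgt_Φ : ∀ i j x, ℋ.tgt (Φ i j x) = ε i ⟨x, x.2.1⟩
  src_Φ : ∀ i j x, ℋ.src (Φ i j x) = ε j ⟨x, x.2.2⟩
  Φ_self : ∀ i (x : M) (hx : x ∈ U.sets i), Φ i i ⟨x, hx, hx⟩ = ℋ.unit (ε i ⟨x, hx⟩)
  Φ_mul : ∀ i j k (x : M) (hi : x ∈ U.sets i) (hj : x ∈ U.sets j) (hk : x ∈ U.sets k),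
    ℋ.mul (Φ i j ⟨x, hi, hj⟩) (Φ j k ⟨x, hj, hk⟩)
      ((src_Φ i j ⟨x, hi, hj⟩).trans (tgt_Φ j k ⟨x, hj, hk⟩).symm) = Φ i k ⟨x, hi, hk⟩

namespace Cocycle

variable {ℋ : LieGroupoid.{u}} {M N : Mfd.{u}} {U : Cover M} {V : Cover N}

/-- Two `1`-cocycles on the same covering are cohomologous if there are smooth local sections `Σᵢ`
with `src Σᵢ = εᵢ`, `tgt Σᵢ = ε'ᵢ` and `Φ'ᵢⱼ = Σᵢ Φᵢⱼ Σⱼ⁻¹`. -/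
def Cohomologous (c c' : Cocycle U ℋ) : Prop :=
  ∃ (S : (i : U.ι) → U.sets i → ℋ.Arr) (hs : ∀ i x, ℋ.src (S i x) = c.ε i x)
    (_ : ∀ i x, ℋ.tgt (S i x) = c'.ε i x),
    (∀ i, ContMDiff 𝓘(ℝ, M.model) 𝓘(ℝ, ℋ.Arr.model) ∞ (S i)) ∧
    ∀ i j (x : (U.sets i ⊓ U.sets j : Opens M)), c'.Φ i j x =
      ℋ.mul (ℋ.mul (S i ⟨x, x.2.1⟩) (c.Φ i j x) ((hs i _).trans (c.tgt_Φ i j x).symm))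
        (ℋ.inv (S j ⟨x, x.2.2⟩))
        (by rw [ℋ.src_mul, ℋ.tgt_inv, c.src_Φ, hs])

theorem smooth_restrict {E : Type*} [NormedAddCommGroup E] [NormedSpace ℝ E] {f : N → M}
    (hf : Mfd.Smooth f) {A : Opens N} {B : Opens M} (h : ∀ x ∈ A, f x ∈ B) {Y : Type*}
    [TopologicalSpace Y] [ChartedSpace E Y] {g : B → Y} (hg : ContMDiff 𝓘(ℝ, M.model) 𝓘(ℝ, E) ∞ g) :
    ContMDiff 𝓘(ℝ, N.model) 𝓘(ℝ, E) ∞ fun x : A => g ⟨f x, h x x.2⟩ := by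
  have h1 : ContMDiff 𝓘(ℝ, N.model) 𝓘(ℝ, M.model) ∞ fun x : A => f x :=
    ContMDiff.comp hf contMDiff_subtype_val
  exact ContMDiff.comp hg ((ContMDiff.subtypeVal_comp_iff B fun x : A => ⟨f x, h x x.2⟩).1 h1)

/-- The cocycle `(εₐ₍ᵢ₎ ∘ f, Φₐ₍ᵢ₎ₐ₍ⱼ₎ ∘ f)` on a covering `V` of `N`, where `f : N → M` maps the
`i`-th set of `V` to the `a i`-th set of `U`. -/
def pull (c : Cocycle U ℋ) (f : N → M) (hf : Mfd.Smooth f) (a : V.ι → U.ι)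
    (h : ∀ i, ∀ x ∈ V.sets i, f x ∈ U.sets (a i)) : Cocycle V ℋ where
  ε i x := c.ε (a i) ⟨f x, h i x x.2⟩
  Φ i j x := c.Φ (a i) (a j) ⟨f x, h i x x.2.1, h j x x.2.2⟩
  smooth_ε i := smooth_restrict hf (h i) (c.smooth_ε (a i))
  smooth_Φ i j := smooth_restrict hf (A := V.sets i ⊓ V.sets j)
    (B := U.sets (a i) ⊓ U.sets (a j)) (fun x hx => ⟨h i x hx.1, h j x hx.2⟩) (c.smooth_Φ (a i) (a j))
  tgt_Φ _ _ _ := c.tgt_Φ _ _ _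
  src_Φ _ _ _ := c.src_Φ _ _ _
  Φ_self _ _ _ := c.Φ_self _ _ _
  Φ_mul i j k x hi hj hk := c.Φ_mul _ _ _ _ (h i x hi) (h j x hj) (h k x hk)

theorem Cohomologous.pull {c c' : Cocycle U ℋ} (hc : Cohomologous c c') (f : N → M)
    (hf : Mfd.Smooth f) (a : V.ι → U.ι) (h : ∀ i, ∀ x ∈ V.sets i, f x ∈ U.sets (a i)) :
    Cohomologous (c.pull f hf a h) (c'.pull f hf a h) := by
  obtain ⟨S, hs, ht, hS, e⟩ := hc
  exact ⟨fun i x => S (a i) ⟨f x, h i x x.2⟩, fun i x => hs (a i) ⟨f x, h i x x.2⟩,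
    fun i x => ht (a i) ⟨f x, h i x x.2⟩, fun i => smooth_restrict hf (h i) (hS (a i)),
    fun i j x => e (a i) (a j) ⟨f x, h i x x.2.1, h j x x.2.2⟩⟩

end Cocycle

/-- The open covering of `𝒢ₙ` by the sets of all `(g₁, …, gₙ)` with `tgt g₁ ∈ U_{α₀}`,
`src gᵢ = tgt gᵢ₊₁ ∈ U_{αᵢ}`, `src gₙ ∈ U_{αₙ}`. -/
def nerveCover {𝒢 : LieGroupoid.{u}} (U : Cover 𝒢.Obj) (n : ℕ) : Cover (𝒢.nerve n) where
  ι := Fin (n + 1) → U.ι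
  sets α := ⟨{y | ∀ i, 𝒢.vertex n y i ∈ U.sets (α i)}, by
    rw [Set.ofPred_forall]
    exact isOpen_iInter_of_finite fun i => (U.sets (α i)).isOpen.preimage (𝒢.continuous_vertex n i)⟩
  covers y := by
    choose α hα using fun i => U.covers (𝒢.vertex n y i)
    exact ⟨α, hα⟩

/-- The cohomology set `H¹(𝒢ₙ, 𝒮_{𝒢ₙ,ℋ})`: the direct limit, over the open coverings of the
objects of `𝒢` and their refinements, of the sets of cohomology classes of `1`-cocycles on the
induced coverings of `𝒢ₙ`. -/
def H1 (𝒢 ℋ : LieGroupoid.{u}) (n : ℕ) : Type (u + 1) :=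
  Quot fun c d : (U : Cover 𝒢.Obj) × Cocycle (nerveCover U n) ℋ =>
    ∃ (a : d.1.ι → c.1.ι) (h : ∀ i, d.1.sets i ≤ c.1.sets (a i)),
      Cocycle.Cohomologous
        (c.2.pull (V := nerveCover d.1 n) id contMDiff_id (fun α i => a (α i))
          fun α _ hy i => h (α i) (hy i)) d.2

/-- The class in `H¹(𝒢ₙ, 𝒮_{𝒢ₙ,ℋ})` of a cocycle on the covering induced by `U`. -/
noncomputable def H1.mk {𝒢 ℋ : LieGroupoid.{u}} {n : ℕ} (U : Cover 𝒢.Obj) (c : Cocycle (nerveCover U n) ℋ) :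
    H1 𝒢 ℋ n := Quot.mk _ ⟨U, c⟩

/-- The map `ρ` from degree `n` to degree `n + 1` induced by the `k`-th face map: pull-back along
the face map, then restriction to the covering of `𝒢ₙ₊₁` by forgetting the `k`-th index. -/
noncomputable def H1.ρ {𝒢 ℋ : LieGroupoid.{u}} (n : ℕ) (k : Fin (n + 2)) : H1 𝒢 ℋ n → H1 𝒢 ℋ (n + 1) :=
  Quot.map (fun c => ⟨c.1, c.2.pull (V := nerveCover c.1 (n + 1)) (𝒢.face n k) (𝒢.smooth_face n k)
      (fun α i => α (k.succAbove i)) fun α y hy i => by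
        rw [𝒢.vertex_face]; exact hy (k.succAbove i)⟩) (by
    rintro ⟨U, c⟩ ⟨V, d⟩ ⟨a, h, e⟩
    exact ⟨a, h, e.pull (V := nerveCover V (n + 1)) (𝒢.face n k) (𝒢.smooth_face n k)
      (fun α i => α (k.succAbove i)) fun α y hy i => by
        rw [𝒢.vertex_face]; exact hy (k.succAbove i)⟩)

/-- The class in `H¹(𝒢₀, 𝒮_{𝒢₀,ℋ})` of a cocycle on a covering of `𝒢₀`, the manifold of objects. -/
noncomputable def H1.ofCocycle {𝒢 ℋ : LieGroupoid.{u}} {U : Cover 𝒢.Obj} (c : Cocycle U ℋ) : H1 𝒢 ℋ 0 :=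
  H1.mk U (Cocycle.pull (N := 𝒢.nerve 0) (V := nerveCover U 0) c id contMDiff_id (fun α => α 0)
    fun _ _ hy => hy 0)

/-- `(ε, Φ)` is the cocycle of the principal bundle `P` for some smooth local sections `σᵢ` of `P`:
`εᵢ` is the momentum of `σᵢ`, and `σⱼ = σᵢ Φᵢⱼ`. -/
def Cocycle.Represents {ℋ : LieGroupoid.{u}} {M : Mfd.{u}} {U : Cover M} (c : Cocycle U ℋ)
    (P : PrincipalBundle ℋ M) : Prop :=
  ∃ (σ : (i : U.ι) → U.sets i → P.total) (hε : ∀ i x, P.momentum (σ i x) = c.ε i x),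
    (∀ i, ContMDiff 𝓘(ℝ, M.model) 𝓘(ℝ, P.total.model) ∞ (σ i)) ∧
    (∀ i x, P.proj (σ i x) = x) ∧
    ∀ i j (x : (U.sets i ⊓ U.sets j : Opens M)), σ j ⟨x, x.2.2⟩ =
      P.act (σ i ⟨x, x.2.1⟩) (c.Φ i j x) ((hε i _).trans (c.tgt_Φ i j x).symm)

/-! A smooth map `Θ : s^* P → t^* P` over the arrows is determined by its second component, `Θ (g,
p) = (g, g p)`. Momentum invariance and `ℋ`-equivariance of `Θ` say that `g p` has the momentum of
`p` and commutes with the right action, and the condition over the composable pairs is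
associativity. The unit law is not among these conditions; it follows from them
(`DescentDatum.unit_lact`), because a unit acts idempotently and `ℋ` acts transitively on the
fibres. Hence the two kinds of data correspond already before classes are taken, and equivalences
match (`genMorClassEquiv`).

For the classes, a cocycle of `P` is pulled back to `𝒢ₙ` along the first vertex (`Cocycle.head`).
Its class depends only on the isomorphism class of the pulled-back bundle: isomorphic bundles have
cohomologous cocycles on a common refinement (`Cocycle.Represents.cohomologous`, `H1.mk_eq`). Every
face map other than the one with `k = 0` preserves the first vertex. The face with `k = 0` replaces
vertex 0 by vertex 1, and the arrow `g₁` from vertex 1 to vertex 0 acts on `P` as an isomorphism of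
the two pull-backs (`GenMor.transport`). This gives compatibility with all `ρ` (`GenMor.ρ_mk_head`).
Uniqueness is induction on `n`: degree 0 is prescribed, since every bundle has a cocycle
(`PrincipalBundle.exists_represents`), and one `ρ` determines each next degree. -/

/-! ### Local sections of submersions. -/

/-- An open subset of a manifold, as a manifold. -/
noncomputable def Mfd.restrict (M : Mfd.{u}) (U : Opens M) : Mfd.{u} where
  carrier := U
  model := M.model

namespace Mfd

/-- The open set is itself taken as the test manifold in the universal property of the fibre
product; this form serves maps that exist only locally, such as sections. -/
theorem contMDiff_pair_opens {M N P Q : Mfd.{u}} {f : M → N} {hf : Smooth f} {π : P → N}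
    {hπ : Submersion π} {U : Opens Q} {a : U → M} {b : U → P}
    (ha : ContMDiff 𝓘(ℝ, Q.model) 𝓘(ℝ, M.model) ∞ a)
    (hb : ContMDiff 𝓘(ℝ, Q.model) 𝓘(ℝ, P.model) ∞ b) (h : ∀ q, f (a q) = π (b q)) :
    ContMDiff 𝓘(ℝ, Q.model) 𝓘(ℝ, (fibProd f hf π hπ).model) ∞
      fun q => (pair (a q) (b q) (h q) : fibProd f hf π hπ) :=
  smooth_pair (Q := Q.restrict U) ha hb h

/-- A submersion has smooth local sections around the image of every point. -/
theorem Submersion.exists_local_section {M P : Mfd.{u}} {π : P → M} (hπ : Submersion π) (p : P) :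
    ∃ (U : Opens M) (_ : π p ∈ U) (σ : U → P),
      ContMDiff 𝓘(ℝ, M.model) 𝓘(ℝ, P.model) ∞ σ ∧ ∀ y, π (σ y) = y := by
  let h := hπ.at p
  let x := π p
  have hid : Smooth (id : M → M) := contMDiff_id
  -- The fibre product along the identity of `M` is a copy of `P`, so its charts, whose inverses
  -- solve `π q = y`, can be used to invert `π` locally.
  let z : Fib (id : M → M) π := ⟨π p, p, rfl⟩
  let e := chartAt M.model x
  let c := (h.equiv (h.domChart p)).2
  -- The section keeps the complementary coordinate constant, equal to its value at `p`, and lets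
  -- only the base coordinate vary.
  let s : M → M.model × hπ.Compl := fun y => (e y, c)
  have hs : ContMDiffOn 𝓘(ℝ, M.model) 𝓘(ℝ, M.model × hπ.Compl) ∞ s e.source :=
    (contMDiffOn_of_mem_maximalAtlas (IsManifold.chart_mem_maximalAtlas
      (I := 𝓘(ℝ, M.model)) (n := ∞) x)).prodMk_space contMDiffOn_const
  have hopen : IsOpen (e.source ∩ s ⁻¹' Fib.chartTarget id x h) :=
    hs.continuousOn.isOpen_inter_preimage e.open_source
      (Fib.chart x h hid.continuous z).open_target
  refine ⟨⟨_, hopen⟩, ⟨mem_chart_source _ _, ?_⟩, fun y => Fib.invSnd id x h (s y), ?_, ?_⟩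
  · have hz : z ∈ (Fib.chart x h hid.continuous z).source :=
      ⟨mem_chart_source _ _, h.mem_domChart_source⟩
    exact (Fib.chart x h hid.continuous z).map_source hz
  · have := (Fib.contMDiffOn_invSnd x h hid).comp (hs.mono Set.inter_subset_left)
      (fun y hy => hy.2)
    exact this.comp_contMDiff contMDiff_subtype_val fun y => y.2
  · intro y
    have := Fib.invSnd_eq (f := id) x h y.2.2
    rw [← this]
    exact e.left_inv y.2.1

end Mfd

/-! ### Division in the fibres and existence of cocycles. -/

namespace PrincipalBundle

variable {ℋ : LieGroupoid.{u}} {M N : Mfd.{u}} (P : PrincipalBundle ℋ M)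

/-- The arrow `h` with `p h = q`, for `p` and `q` in the same fibre. -/
noncomputable def div (p q : P.total) (e : P.proj p = P.proj q) : ℋ.Arr :=
  P.exists_div.choose (Mfd.pair p q e)

theorem tgt_div (p q : P.total) (e : P.proj p = P.proj q) :
    P.momentum p = ℋ.tgt (P.div p q e) :=
  (P.exists_div.choose_spec.2 (Mfd.pair p q e)).1

theorem act_div (p q : P.total) (e : P.proj p = P.proj q) :
    P.act p (P.div p q e) (P.tgt_div p q e) = q :=
  (P.exists_div.choose_spec.2 (Mfd.pair p q e)).2

theorem src_div (p q : P.total) (e : P.proj p = P.proj q) :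
    ℋ.src (P.div p q e) = P.momentum q := by
  rw [← P.momentum_act p _ (P.tgt_div p q e), act_div]

/-- Division is a component of the inverse of the shear diffeomorphism, hence smooth. -/
theorem smooth_div {U : Opens N} {a b : U → P.total}
    (ha : ContMDiff 𝓘(ℝ, N.model) 𝓘(ℝ, P.total.model) ∞ a)
    (hb : ContMDiff 𝓘(ℝ, N.model) 𝓘(ℝ, P.total.model) ∞ b)
    (e : ∀ x, P.proj (a x) = P.proj (b x)) :
    ContMDiff 𝓘(ℝ, N.model) 𝓘(ℝ, ℋ.Arr.model) ∞ fun x => P.div (a x) (b x) (e x) :=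
  ContMDiff.comp P.exists_div.choose_spec.1 (Mfd.contMDiff_pair_opens ha hb e)

theorem act_congr {p q : P.total} {h : ℋ.Arr} (e : p = q) (w : P.momentum p = ℋ.tgt h)
    (w' : P.momentum q = ℋ.tgt h) : P.act p h w = P.act q h w' := by
  subst e; rfl

/-- The identity morphism. -/
def Hom.id : Hom P P where
  toFun p := p
  smooth := contMDiff_id
  proj _ := rfl
  momentum _ := rfl
  act _ _ _ := rfl

/-- Every principal bundle has a cocycle. -/
theorem exists_represents : ∃ (U : Cover M) (ξ : Cocycle U ℋ), ξ.Represents P := by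
  choose p hp using P.surjective_proj
  choose U hU σ hσ hπ using fun x => P.submersion_proj.exists_local_section (p x)
  -- The points of `M` index the covering: the section chosen through `p x` is defined near `π (p x)
  -- = x`.
  let V : Cover M := ⟨M, U, fun x => ⟨x, by have := hU x; rwa [hp] at this⟩⟩
  have e (i j : M) (x : (U i ⊓ U j : Opens M)) :
      P.proj (σ i ⟨x, x.2.1⟩) = P.proj (σ j ⟨x, x.2.2⟩) := by rw [hπ, hπ]
  let Φ (i j : M) (x : (U i ⊓ U j : Opens M)) : ℋ.Arr := P.div _ _ (e i j x)
  refine ⟨V, ⟨fun i x => P.momentum (σ i x), Φ,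
    fun i => ContMDiff.comp P.smooth_momentum (hσ i), fun i j => ?_, fun i j x => ?_,
    fun i j x => ?_, fun i x hx => ?_, fun i j k x hi hj hk => ?_⟩,
    σ, fun _ _ => rfl, hσ, hπ, fun i j x => ?_⟩
  · have hid : Mfd.Smooth (fun x : M => x) := contMDiff_id
    exact P.smooth_div
      (Cocycle.smooth_restrict hid (A := U i ⊓ U j) (fun x hx => hx.1) (hσ i))
      (Cocycle.smooth_restrict hid (A := U i ⊓ U j) (fun x hx => hx.2) (hσ j)) _
  · exact (P.tgt_div _ _ _).symm
  · exact P.src_div _ _ _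
  -- The action is free, so identities between arrows are checked after applying them to a section.
  · refine P.act_injective (p := σ i ⟨x, hx⟩) (P.tgt_div _ _ _) (ℋ.tgt_unit _).symm ?_
    rw [P.act_unit]
    exact P.act_div _ _ _
  -- Both sides carry `σ i` to `σ k`, the left one by way of `σ j`.
  · refine P.act_injective (p := σ i ⟨x, hi⟩) ((P.tgt_div _ _ _).trans (ℋ.tgt_mul _ _ _).symm)
      (P.tgt_div _ _ _) ?_
    have h1 := P.act_div _ _ (e i j ⟨x, hi, hj⟩)
    have h2 := P.act_div _ _ (e j k ⟨x, hj, hk⟩)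
    have h3 := P.act_div _ _ (e i k ⟨x, hi, hk⟩)
    refine Eq.trans ?_ h3.symm
    refine Eq.trans (P.act_mul _ _ _ (P.tgt_div _ _ _) ?_) ?_
    · exact (P.src_div _ _ _).trans (P.tgt_div _ _ _)
    · exact (P.act_congr h1 _ _).trans h2
  · exact (P.act_div _ _ _).symm

end PrincipalBundle

/-! ### Cocycles of isomorphic bundles and their classes. -/

theorem LieGroupoid.eq_mul_inv_of_mul_eq (ℋ : LieGroupoid.{u}) {a b c : ℋ.Arr}
    (w : ℋ.src a = ℋ.tgt b) (e : ℋ.mul a b w = c) :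
    a = ℋ.mul c (ℋ.inv b) (by rw [← e, ℋ.src_mul, ℋ.tgt_inv]) := by
  subst e
  rw [ℋ.mul_assoc _ _ _ w (ℋ.tgt_inv b).symm]
  simp only [ℋ.mul_inv, ← w, ℋ.mul_unit]

namespace Cocycle

variable {ℋ : LieGroupoid.{u}} {M N : Mfd.{u}} {U : Cover M} {V : Cover N}

/-- The pull-back of a cocycle of `P` is a cocycle of the pull-back of `P`. -/
theorem Represents.pull {c : Cocycle U ℋ} {P : PrincipalBundle ℋ M} (hc : c.Represents P)
    (f : N → M) (hf : Mfd.Smooth f) (a : V.ι → U.ι)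
    (h : ∀ i, ∀ x ∈ V.sets i, f x ∈ U.sets (a i)) :
    (c.pull f hf a h).Represents (P.pullback f hf) := by
  obtain ⟨σ, hε, hσ, hπ, e⟩ := hc
  refine ⟨fun i x => Mfd.pair (x : N) (σ (a i) ⟨f x, h i x x.2⟩)
    (hπ (a i) ⟨f x, h i x x.2⟩).symm, fun i x => hε _ _,
    fun i => ?_, fun _ _ => rfl, fun i j x => ?_⟩
  · exact Mfd.contMDiff_pair_opens contMDiff_subtype_val (smooth_restrict hf (h i) (hσ (a i))) _
  · exact Mfd.fibProd_ext rfl (e (a i) (a j) ⟨f x, h i x x.2.1, h j x x.2.2⟩)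

/-- The restriction of a cocycle of `P` to a refinement is a cocycle of `P`. -/
theorem Represents.refine {U V : Cover M} {c : Cocycle U ℋ} {P : PrincipalBundle ℋ M}
    (hc : c.Represents P) (a : V.ι → U.ι) (h : ∀ i, ∀ x ∈ V.sets i, x ∈ U.sets (a i)) :
    (c.pull id contMDiff_id a h).Represents P := by
  obtain ⟨σ, hε, hσ, hπ, e⟩ := hc
  have hid : Mfd.Smooth (fun x : M => x) := contMDiff_id
  exact ⟨fun i x => σ (a i) ⟨x, h i x x.2⟩, fun i x => hε _ _,
    fun i => smooth_restrict hid (h i) (hσ (a i)), fun _ _ => hπ _ _,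
    fun i j x => e (a i) (a j) ⟨x, h i x x.2.1, h j x x.2.2⟩⟩

/-- Cocycles of isomorphic bundles on the same covering are cohomologous. -/
theorem Represents.cohomologous {c d : Cocycle U ℋ} {P Q : PrincipalBundle ℋ M}
    (hc : c.Represents P) (hd : d.Represents Q) (S : PrincipalBundle.Hom P Q) :
    Cohomologous c d := by
  obtain ⟨σ, hε, hσ, hπ, e⟩ := hc
  obtain ⟨τ, hε', hτ, hπ', e'⟩ := hd
  -- The cochain is `Σᵢ = Q.div (τᵢ) (S σᵢ)`, the arrow with `τᵢ Σᵢ = S σᵢ`. This order gives it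
  -- source `εᵢ` and target `ε'ᵢ`.
  have E (i : U.ι) (x : U.sets i) : Q.proj (τ i x) = Q.proj (S.toFun (σ i x)) := by
    rw [hπ', S.proj, hπ]
  have hs (i : U.ι) (x : U.sets i) : ℋ.src (Q.div _ _ (E i x)) = c.ε i x := by
    rw [Q.src_div, S.momentum, hε]
  have ht (i : U.ι) (x : U.sets i) : ℋ.tgt (Q.div _ _ (E i x)) = d.ε i x := by
    rw [← Q.tgt_div, hε']
  refine ⟨fun i x => Q.div _ _ (E i x), hs, ht,
    fun i => Q.smooth_div (hτ i) (ContMDiff.comp S.smooth (hσ i)) _, fun i j x => ?_⟩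
  -- It suffices that `Φ'ᵢⱼ Σⱼ = Σᵢ Φᵢⱼ`. By freeness this is tested on `τᵢ`: `τᵢ Φ'ᵢⱼ Σⱼ = τⱼ Σⱼ =
  -- S σⱼ = S (σᵢ Φᵢⱼ) = (S σᵢ) Φᵢⱼ = τᵢ Σᵢ Φᵢⱼ`.
  refine ℋ.eq_mul_inv_of_mul_eq ((d.src_Φ i j x).trans (ht j _).symm) ?_
  refine Q.act_injective (p := τ i ⟨x, x.2.1⟩) ?_ ?_ ?_
  · rw [hε', ℋ.tgt_mul, d.tgt_Φ]
  · rw [hε', ℋ.tgt_mul, ht]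
  · have w1 : Q.momentum (τ i ⟨x, x.2.1⟩) = ℋ.tgt (d.Φ i j x) := by rw [hε', d.tgt_Φ]
    refine (Q.act_mul _ _ _ w1 _).trans ?_
    refine (Q.act_congr (e' i j x).symm _ (Q.tgt_div _ _ _)).trans ?_
    refine (Q.act_div _ _ _).trans ?_
    refine Eq.trans ?_ (Q.act_mul _ _ _ (Q.tgt_div _ _ _) ((hs i _).trans (c.tgt_Φ i j x).symm)).symm
    rw [e i j x, S.act]
    exact Q.act_congr (Q.act_div _ _ _).symm _ _

end Cocycle

/-- The common refinement of two coverings. -/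
def Cover.inf {M : Mfd.{u}} (U V : Cover M) : Cover M where
  ι := U.ι × V.ι
  sets i := U.sets i.1 ⊓ V.sets i.2
  covers x := by
    obtain ⟨i, hi⟩ := U.covers x
    obtain ⟨j, hj⟩ := V.covers x
    exact ⟨(i, j), hi, hj⟩

/-- Cocycles of isomorphic bundles over `𝒢ₙ` have the same class. -/
theorem H1.mk_eq {𝒢 ℋ : LieGroupoid.{u}} {n : ℕ} {U V : Cover 𝒢.Obj}
    {c : Cocycle (nerveCover U n) ℋ} {d : Cocycle (nerveCover V n) ℋ}
    {P Q : PrincipalBundle ℋ (𝒢.nerve n)} (hc : c.Represents P) (hd : d.Represents Q)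
    (S : PrincipalBundle.Hom P Q) : H1.mk U c = H1.mk V d := by
  have hV (α : (nerveCover (U.inf V) n).ι) (y : 𝒢.nerve n)
      (hy : y ∈ (nerveCover (U.inf V) n).sets α) :
      y ∈ (nerveCover V n).sets fun i => (α i).2 := fun i => (hy i).2
  have hU (α : (nerveCover (U.inf V) n).ι) (y : 𝒢.nerve n)
      (hy : y ∈ (nerveCover (U.inf V) n).sets α) :
      y ∈ (nerveCover U n).sets fun i => (α i).1 := fun i => (hy i).1
  have hd' := hd.refine (V := nerveCover (U.inf V) n) (fun α i => (α i).2) hV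
  have hc' := hc.refine (V := nerveCover (U.inf V) n) (fun α i => (α i).1) hU
  -- The relation that defines `H1` goes from a covering to a refinement. Both classes are therefore
  -- compared with the restriction of `d` to the common refinement: `c` through `S`, and `d` through
  -- the identity of `Q`, which supplies reflexivity.
  trans H1.mk (U.inf V) (d.pull (V := nerveCover (U.inf V) n) id contMDiff_id
    (fun α i => (α i).2) hV)
  · exact Quot.sound ⟨Prod.fst, fun i => inf_le_left, hc'.cohomologous hd' S⟩
  · exact (Quot.sound ⟨Prod.snd, fun i => inf_le_right,
      hd'.cohomologous hd' (PrincipalBundle.Hom.id Q)⟩).symm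

/-! ### From left actions to compatible morphisms. -/

namespace GenMor

variable {𝒢 ℋ : LieGroupoid.{u}}

theorem lact_congr (P : GenMor 𝒢 ℋ) {g g' : 𝒢.Arr} {p p' : P.bundle.total} (e : g = g')
    (e' : p = p') (w : 𝒢.src g = P.bundle.proj p) (w' : 𝒢.src g' = P.bundle.proj p') :
    P.lact g p w = P.lact g' p' w' := by
  subst e e'; rfl

/-- The left action along a smooth family of arrows from `f x` to `f' x`, as a morphism of bundles
`f^* P → f'^* P`. -/
noncomputable def transport (P : GenMor 𝒢 ℋ) {N : Mfd.{u}} {f f' : N → 𝒢.Obj}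
    (hf : Mfd.Smooth f) (hf' : Mfd.Smooth f') (g : N → 𝒢.Arr) (hg : Mfd.Smooth g)
    (hs : ∀ x, 𝒢.src (g x) = f x) (ht : ∀ x, 𝒢.tgt (g x) = f' x) :
    PrincipalBundle.Hom (P.bundle.pullback f hf) (P.bundle.pullback f' hf') where
  toFun z := Mfd.pair (Mfd.pr₁ z)
    (P.lact (g (Mfd.pr₁ z)) (Mfd.pr₂ z) ((hs _).trans (Mfd.pr_w z)))
    ((ht _).symm.trans (P.proj_lact _ _ _).symm)
  smooth := Mfd.smooth_pair Mfd.smooth_pr₁ (ContMDiff.comp P.smooth_lact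
    (Mfd.smooth_pair (ContMDiff.comp hg Mfd.smooth_pr₁) Mfd.smooth_pr₂
      fun z => (hs _).trans (Mfd.pr_w z))) _
  proj _ := rfl
  momentum _ := P.momentum_lact _ _ _
  act _ _ _ := Mfd.fibProd_ext rfl (P.lact_act _ _ _ _ _)

/-- The morphism `Θ (g, p) = (g, g p)`. -/
noncomputable def theta (P : GenMor 𝒢 ℋ) :
    (P.bundle.pullback 𝒢.src 𝒢.smooth_src).Hom (P.bundle.pullback 𝒢.tgt 𝒢.smooth_tgt) :=
  -- The identity of the manifold of arrows is the universal family of arrows from source to target.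
  P.transport 𝒢.smooth_src 𝒢.smooth_tgt id contMDiff_id (fun _ => rfl) fun _ => rfl

/-- This is associativity of the left action, evaluated at a point of `μ^* s^* P`. -/
theorem isCompatible_theta (P : GenMor 𝒢 ℋ) : IsCompatible P.theta := by
  refine PrincipalBundle.Hom.ext (funext fun z => ?_)
  -- A point of `μ^* s^* P` is `((g₁, g₂), (g, p))` with `g = g₁ g₂` only propositionally; `Mfd.pr_w
  -- z` is this equation, and it also replaces `g` by the product in the action.
  refine Mfd.fibProd_ext rfl (Mfd.fibProd_ext (Mfd.pr_w z).symm ?_)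
  have w : 𝒢.src (𝒢.μ (Mfd.pr₁ z)) = P.bundle.proj (Mfd.pr₂ (Mfd.pr₂ z)) :=
    (congrArg 𝒢.src (Mfd.pr_w z)).trans (Mfd.pr_w (Mfd.pr₂ z))
  exact (P.lact_congr (Mfd.pr_w z).symm rfl _ w).trans
    (P.mul_lact _ _ _ _ ((𝒢.src_mul _ _ _).symm.trans w))

/-- The pair `(P, Θ)` of a generalized morphism. -/
noncomputable def toDescentDatum (P : GenMor 𝒢 ℋ) : DescentDatum 𝒢 ℋ :=
  ⟨P.bundle, P.theta, P.isCompatible_theta⟩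

end GenMor

/-! ### From compatible morphisms to left actions. -/

namespace DescentDatum

variable {𝒢 ℋ : LieGroupoid.{u}} (D : DescentDatum 𝒢 ℋ)

/-- The second component of `Θ`. -/
noncomputable def lact (g : 𝒢.Arr) (p : D.bundle.total) (w : 𝒢.src g = D.bundle.proj p) :
    D.bundle.total :=
  Mfd.pr₂ (D.Θ.toFun (Mfd.pair g p w))

theorem smooth_lact : Mfd.Smooth
    fun z : Mfd.fibProd 𝒢.src 𝒢.smooth_src D.bundle.proj D.bundle.submersion_proj =>
      D.lact (Mfd.pr₁ z) (Mfd.pr₂ z) (Mfd.pr_w z) := by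
  have h : Mfd.Smooth (M := (D.bundle.pullback 𝒢.tgt 𝒢.smooth_tgt).total) (N := D.bundle.total)
      fun z => Mfd.pr₂ z := Mfd.smooth_pr₂
  exact ContMDiff.comp h D.Θ.smooth

theorem Θ_pair (g : 𝒢.Arr) (p : D.bundle.total) (w : 𝒢.src g = D.bundle.proj p) :
    Mfd.pr₁ (D.Θ.toFun (Mfd.pair g p w)) = g := D.Θ.proj _

theorem proj_lact (g : 𝒢.Arr) (p : D.bundle.total) (w : 𝒢.src g = D.bundle.proj p) :
    D.bundle.proj (D.lact g p w) = 𝒢.tgt g := by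
  have h := Mfd.pr_w (D.Θ.toFun (Mfd.pair g p w))
  exact h.symm.trans (congrArg 𝒢.tgt (D.Θ_pair g p w))

/-- The compatibility condition is evaluated at `((g₁, g₂), (g₁ g₂, p))`, and the component in `P`
is read off. -/
theorem mul_lact (g₁ g₂ : 𝒢.Arr) (p : D.bundle.total) (w₁ : 𝒢.src g₁ = 𝒢.tgt g₂)
    (w₂ : 𝒢.src g₂ = D.bundle.proj p) :
    D.lact (𝒢.mul g₁ g₂ w₁) p ((𝒢.src_mul g₁ g₂ w₁).trans w₂) =
      D.lact g₁ (D.lact g₂ p w₂) (w₁.trans (D.proj_lact g₂ p w₂).symm) := by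
  have := congrFun (congrArg PrincipalBundle.Hom.toFun D.compatible)
    (Mfd.pair (Mfd.pair g₁ g₂ w₁) (Mfd.pair (𝒢.mul g₁ g₂ w₁) p ((𝒢.src_mul g₁ g₂ w₁).trans w₂)) rfl)
  exact congrArg (fun z => Mfd.pr₂ (Mfd.pr₂ z)) this

theorem momentum_lact (g : 𝒢.Arr) (p : D.bundle.total) (w : 𝒢.src g = D.bundle.proj p) :
    D.bundle.momentum (D.lact g p w) = D.bundle.momentum p := D.Θ.momentum _

theorem lact_act (g : 𝒢.Arr) (p : D.bundle.total) (h : ℋ.Arr) (w : 𝒢.src g = D.bundle.proj p)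
    (w' : D.bundle.momentum p = ℋ.tgt h) :
    D.lact g (D.bundle.act p h w') (w.trans (D.bundle.proj_act p h w').symm) =
      D.bundle.act (D.lact g p w) h ((D.momentum_lact g p w).trans w') :=
  congrArg Mfd.pr₂ (D.Θ.act (Mfd.pair g p w) h w')

theorem lact_congr {g g' : 𝒢.Arr} {p p' : D.bundle.total} (e : g = g')
    (e' : p = p') (w : 𝒢.src g = D.bundle.proj p) (w' : 𝒢.src g' = D.bundle.proj p') :
    D.lact g p w = D.lact g' p' w' := by
  subst e e'; rfl

/-- Put `q = u p` for the unit `u`. Since `u u = u`, also `u q = q`. As `q` lies in the fibre of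
`p`, there is `h` with `q h = p`, and then `q = u p = u (q h) = (u q) h = q h = p`. -/
theorem unit_lact (p : D.bundle.total) :
    D.lact (𝒢.unit (D.bundle.proj p)) p (𝒢.src_unit _) = p := by
  let P := D.bundle
  let u := 𝒢.unit (P.proj p)
  let q := D.lact u p (𝒢.src_unit _)
  have hq : P.proj q = P.proj p := (D.proj_lact _ _ _).trans (𝒢.tgt_unit _)
  have hw : 𝒢.src u = 𝒢.tgt u := (𝒢.src_unit _).trans (𝒢.tgt_unit _).symm
  have huu : 𝒢.mul u u hw = u := by
    have := 𝒢.mul_unit u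
    simp only [u, 𝒢.src_unit] at this
    exact this
  have h1 : D.lact u q ((𝒢.src_unit _).trans hq.symm) = q :=
    (D.mul_lact u u p hw (𝒢.src_unit _)).symm.trans (D.lact_congr huu rfl _ _)
  have h2 := P.act_div q p hq
  have h3 := D.lact_act u q _ ((𝒢.src_unit _).trans hq.symm) (P.tgt_div q p hq)
  calc q = D.lact u (P.act q (P.div q p hq) (P.tgt_div q p hq)) _ :=
        D.lact_congr rfl h2.symm _ ((𝒢.src_unit _).trans (hq.symm.trans (P.proj_act _ _ _).symm))
    _ = _ := h3
    _ = _ := P.act_congr h1 _ _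
    _ = p := h2

/-- The generalized morphism with left action `Θ (g, p) = (g, g p)`. -/
noncomputable def toGenMor : GenMor 𝒢 ℋ where
  bundle := D.bundle
  lact := D.lact
  smooth_lact := D.smooth_lact
  proj_lact := D.proj_lact
  unit_lact := D.unit_lact
  mul_lact := D.mul_lact
  momentum_lact := D.momentum_lact
  lact_act := D.lact_act

/-- Nothing is lost by keeping only the second component of `Θ`: the first is forced because `Θ`
covers the identity of the arrows. -/
theorem theta_toGenMor : D.toGenMor.theta = D.Θ :=
  PrincipalBundle.Hom.ext (funext fun z => Mfd.fibProd_ext (D.Θ.proj z).symm rfl)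

end DescentDatum

/-! ### The bijection of classes. -/

/-- Generalized morphisms up to equivalence are pairs `(P, Θ)` up to equivalence. -/
noncomputable def genMorClassEquiv (𝒢 ℋ : LieGroupoid.{u}) :
    GenMorClass 𝒢 ℋ ≃ DescentClass 𝒢 ℋ where
  -- The same `S` serves in both directions: the second component of `t^* S ∘ Θ = Η ∘ s^* S` at `(g,
  -- p)` is `S (g p) = g (S p)`.
  toFun := Quot.map GenMor.toDescentDatum fun P Q ⟨S, hS⟩ =>
    ⟨S, PrincipalBundle.Hom.ext (funext fun z => Mfd.fibProd_ext rfl (hS _ _ (Mfd.pr_w z)))⟩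
  invFun := Quot.map DescentDatum.toGenMor fun D E ⟨S, hS⟩ => ⟨S, fun g p w =>
    congrArg Mfd.pr₂ (congrFun (congrArg PrincipalBundle.Hom.toFun hS) (Mfd.pair g p w))⟩
  left_inv := by
    rintro ⟨P⟩
    rfl
  right_inv := by
    rintro ⟨D⟩
    -- The representatives themselves agree, not just their classes.
    refine congrArg (Quot.mk _) ?_
    change (⟨D.bundle, D.toGenMor.theta, _⟩ : DescentDatum 𝒢 ℋ) = D
    have := D.theta_toGenMor
    obtain ⟨P, Θ, h⟩ := D
    congr

/-! ### The classes on the nerve. -/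

/-- The pull-back of a cocycle along the first vertex `𝒢ₙ → 𝒢₀`. -/
noncomputable def Cocycle.head {𝒢 ℋ : LieGroupoid.{u}} {U : Cover 𝒢.Obj} (ξ : Cocycle U ℋ) (n : ℕ) :
    Cocycle (nerveCover U n) ℋ :=
  ξ.pull (𝒢.headVertex n) (𝒢.smooth_headVertex n) (fun α => α 0) fun _ y hy => by
    rw [← 𝒢.vertex_zero]; exact hy 0

namespace GenMor

variable {𝒢 ℋ : LieGroupoid.{u}}

/-- Isomorphic bundles have the same classes on `𝒢ₙ`. -/
theorem mk_head_eq {P Q : GenMor 𝒢 ℋ} (S : PrincipalBundle.Hom P.bundle Q.bundle)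
    {U V : Cover 𝒢.Obj} {ξ : Cocycle U ℋ} {η : Cocycle V ℋ} (hξ : ξ.Represents P.bundle)
    (hη : η.Represents Q.bundle) (n : ℕ) : H1.mk U (ξ.head n) = H1.mk V (η.head n) :=
  H1.mk_eq (hξ.pull _ _ _ _) (hη.pull _ _ _ _)
    (S.pullback (𝒢.headVertex n) (𝒢.smooth_headVertex n))

/-- The classes on `𝒢ₙ` of the bundle of a generalized morphism are compatible with the maps `ρ`. -/
theorem ρ_mk_head {P : GenMor 𝒢 ℋ} {U : Cover 𝒢.Obj} {ξ : Cocycle U ℋ}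
    (hξ : ξ.Represents P.bundle) (n : ℕ) (k : Fin (n + 2)) :
    H1.ρ n k (H1.mk U (ξ.head n)) = H1.mk U (ξ.head (n + 1)) := by
  have hf : Mfd.Smooth fun y => 𝒢.headVertex n (𝒢.face n k y) :=
    ContMDiff.comp (𝒢.smooth_headVertex n) (𝒢.smooth_face n k)
  -- The two classes come from the pull-backs of `P` along `headVertex ∘ face` and along
  -- `headVertex`. A smooth family of arrows from the first map to the second makes these bundles
  -- isomorphic.
  suffices h : ∃ g : 𝒢.nerve (n + 1) → 𝒢.Arr, Mfd.Smooth g ∧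
      (∀ y, 𝒢.src (g y) = 𝒢.headVertex n (𝒢.face n k y)) ∧
      ∀ y, 𝒢.tgt (g y) = 𝒢.headVertex (n + 1) y by
    obtain ⟨g, hg, hs, ht⟩ := h
    -- Vertex 0 of the `k`-th face is vertex `k.succAbove 0` of the tuple, that is vertex 1 for `k =
    -- 0` and vertex 0 otherwise; the same index is selected in the covering.
    exact H1.mk_eq (hξ.pull (V := nerveCover U (n + 1)) _ hf (fun α => α (k.succAbove 0)) fun α y hy => by
        rw [← 𝒢.vertex_zero, 𝒢.vertex_face]; exact hy _) (hξ.pull _ _ _ _)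
      (P.transport hf (𝒢.smooth_headVertex (n + 1)) g hg hs ht)
  refine Fin.cases ?_ (fun k => ?_) k
  -- For `k = 0` the family is `g₁`, which goes from vertex 1 to vertex 0. This is the only face for
  -- which the left action does real work.
  · exact ⟨𝒢.headArrow n, 𝒢.smooth_headArrow n, fun y => (𝒢.headVertex_tail n y).symm,
      fun y => (𝒢.headVertex_succ n y).symm⟩
  -- The other faces fix the first vertex, so units suffice.
  · exact ⟨fun y => 𝒢.unit (𝒢.headVertex (n + 1) y),
      ContMDiff.comp 𝒢.smooth_unit (𝒢.smooth_headVertex (n + 1)),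
      fun y => (𝒢.src_unit _).trans ((𝒢.faceSucc n k).2.2 y).symm, fun y => 𝒢.tgt_unit _⟩

/-- The sequence of classes of a generalized morphism. -/
noncomputable def cechClass (P : GenMor 𝒢 ℋ) (n : ℕ) : H1 𝒢 ℋ n :=
  H1.mk _ (P.bundle.exists_represents.choose_spec.choose.head n)

/-- Independence of the chosen cocycle: two cocycles of one bundle are compared through its identity
morphism. -/
theorem cechClass_eq (P : GenMor 𝒢 ℋ) {U : Cover 𝒢.Obj} {ξ : Cocycle U ℋ}
    (hξ : ξ.Represents P.bundle) (n : ℕ) : P.cechClass n = H1.mk U (ξ.head n) :=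
  mk_head_eq (PrincipalBundle.Hom.id _) P.bundle.exists_represents.choose_spec.choose_spec hξ n

end GenMor

/-! ### The theorem. -/

theorem mainTheorem7 (𝒢 ℋ : LieGroupoid.{u}) :
    -- equivalence classes of generalized morphisms are equivalence classes of pairs `(P, Θ)`, where
    -- `Θ (g, p) = (g, g p)` corresponds to the left action `g p` on `P`
    (∃ Ψ : GenMorClass 𝒢 ℋ ≃ DescentClass 𝒢 ℋ, ∀ P : GenMor 𝒢 ℋ,
      ∃ (Θ : (P.bundle.pullback 𝒢.src 𝒢.smooth_src).Hom (P.bundle.pullback 𝒢.tgt 𝒢.smooth_tgt))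
        (hΘ : IsCompatible Θ),
        (∀ (g : 𝒢.Arr) (p : P.bundle.total) (w : 𝒢.src g = P.bundle.proj p),
          Θ.toFun (Mfd.pair g p w) = Mfd.pair g (P.lact g p w) (P.proj_lact g p w).symm) ∧
        Ψ (Quot.mk _ P) = Quot.mk _ ⟨P.bundle, Θ, hΘ⟩) ∧
    -- each class gives a sequence of Čech classes, compatible with all the maps `ρ`, which starts
    -- with the class of the underlying principal bundle
    (∃! c : GenMorClass 𝒢 ℋ → (n : ℕ) → H1 𝒢 ℋ n,
      (∀ x n (k : Fin (n + 2)), H1.ρ n k (c x n) = c x (n + 1)) ∧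
      ∀ (P : GenMor 𝒢 ℋ) (U : Cover 𝒢.Obj) (ξ : Cocycle U ℋ), ξ.Represents P.bundle →
        c (Quot.mk _ P) 0 = H1.ofCocycle ξ) := by
  refine ⟨⟨genMorClassEquiv 𝒢 ℋ, fun P => ⟨P.theta, P.isCompatible_theta, fun _ _ _ => rfl, rfl⟩⟩,
    Quot.lift GenMor.cechClass ?_, ⟨?_, ?_⟩, ?_⟩
  -- The classes see only the underlying bundle, so the `𝒢`-equivariance of `S` is dropped.
  · rintro P Q ⟨S, -⟩
    obtain ⟨U, ξ, hξ⟩ := P.bundle.exists_represents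
    obtain ⟨V, η, hη⟩ := Q.bundle.exists_represents
    funext n
    rw [P.cechClass_eq hξ, Q.cechClass_eq hη]
    exact GenMor.mk_head_eq S hξ hη n
  · rintro ⟨P⟩ n k
    exact GenMor.ρ_mk_head P.bundle.exists_represents.choose_spec.choose_spec n k
  · intro P U ξ hξ
    -- On `𝒢₀` the first vertex is the identity map, so `ξ.head 0` is by definition the cocycle in
    -- `H1.ofCocycle`.
    exact P.cechClass_eq hξ 0
  · rintro c ⟨hρ, h0⟩
    funext x n
    obtain ⟨P⟩ := x
    obtain ⟨U, ξ, hξ⟩ := P.bundle.exists_represents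
    refine Eq.trans ?_ (P.cechClass_eq hξ n).symm
    induction n with
    | zero => exact h0 P U ξ hξ
    | succ n ih =>
      -- Both sequences satisfy the recursion for the face `k = 0`; this one face already determines
      -- the next class.
      exact (hρ _ n 0).symm.trans <| (congrArg (H1.ρ n 0) ih).trans (GenMor.ρ_mk_head hξ n 0)
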